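/- **Setting.** A network is a finite directed graph $G=(V,E)$ with a colouring $f:V\to\{B,R\}$ (blue, red). For a vertex $v$ let $N^+(v)$ be its set of out-neighbours and $r_v$, $b_v$ the numbers of red and of blue vertices in $N^+(v)$. The vertex $v$ is *under illusion* if $r_v>b_v$; for a rational $p\in[0,1]$ it is *under $p$-illusion* if $b_v<\lceil p\,|N^+(v)|\rceil$. A colouring is *illusion-free* (*$p$-illusion-free*) if no vertex is under illusion ($p$-illusion) in it. The problem DIFR ($p$-DIFR) asks, given $G$, $f$ and an integer $k\ge 0$ (and, for $p$-DIFR, a rational $p\in[0,1]$), whether there is an illusion-free ($p$-illusion-free) colouring $f'$ with $|\{v: f(v)\neq f'(v)\}|\le k$. A *minimum recolouring* is an illusion-free ($p$-illusion-free) $f'$ for which $|\{v: f(v)\neq f'(v)\}|$ is least possible. For $m,n\ge 1$, an *$m\times n$ outward grid* is a directed graph isomorphic to the one with vertices $(i,j)$, $0\le i<m$, $0\le j<n$, in which the out-neighbours of $(i,j)$ are $(i,j+1)$ and $(i+1,j)$, as far as these exist. The machine is a word RAM with unit-cost instructions (constants, copying, addition, truncated subtraction, indirect reading and writing of memory, comparison),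 with words of $\log_2(S)+O(1)$ bits, $S$ being the maximum of the number of input words and of the numbers in the input. The input consists of $|V|$, $k$ (and the numerator and denominator of $p$), the colours, and the adjacency lists of $G$ (a table of offsets and the concatenated lists of out-neighbours) for an arbitrary numbering of the vertices and an arbitrary order of each list; no grid embedding is given. **Proposition.** 1. There is an algorithm which, on every instance $(G,f,k)$ with $G$ an $m\times n$ outward grid, $m,n\ge1$, decides DIFR, and outputs a minimum recolouring, in time $O(mn\sqrt{mn})$. 2. There is an algorithm which, on every instance $(G,f,k,p)$ with $G$ an $m\times n$ outward grid, $m,n\ge 1$, and $p\in[0,1]$ rational, decides $p$-DIFR, and outputs a minimum recolouring for $p$-illusion, in time $O(mn\sqrt{mn})$. 3. Let $G$ be an outward grid with colouring $f$. Let $f_1$ be obtained from $f$ by recolouring blue every red vertex $v$ such that $N^+(x)=\{v\}$ for some vertex $x$. Let $H$ be the undirected graph whose vertices are the red vertices of $f_1$ and in which two distinct vertices $a,b$ are joined if $N^+(x)=\{a,b\}$ for some $x$ under illusion in $f_1$. Then $H$ is acyclic, and for every minimum vertex cover $S$ of $H$, recolouring the vertices of $S$ blue in $f_1$ gives a minimum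 (illusion-free) recolouring of $f$. The constants in 1 and 2 are absolute. -/

import Mathlib

/-! ### Coloured directed networks and illusion -/

/-- The two colours of a vertex. -/
inductive Color where
  | blue
  | red

namespace Color

/-- The encoding of a colour as a machine word. -/
def code : Color → ℕ
  | blue => 0
  | red => 1

end Color

section Illusion

variable {V : Type*}

/-- The out-neighbourhood `N⁺(v)`. -/
def outNbrs (G : Digraph V) (v : V) : Set V := {u | G.Adj v u}

/-- `r_v`, the number of red out-neighbours of `v`. -/
noncomputable def redCount (G : Digraph V) (f : V → Color) (v : V) : ℕ :=
  (outNbrs G v ∩ {u | f u = Color.red}).ncard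

/-- `b_v`, the number of blue out-neighbours of `v`. -/
noncomputable def blueCount (G : Digraph V) (f : V → Color) (v : V) : ℕ :=
  (outNbrs G v ∩ {u | f u = Color.blue}).ncard

/-- The deficiency `max {0, r_v - b_v}` (the subtraction of natural numbers truncates at `0`). -/
noncomputable def deficiency (G : Digraph V) (f : V → Color) (v : V) : ℕ :=
  redCount G f v - blueCount G f v

/-- A vertex is under (majority) illusion if its deficiency is positive, that is `b_v < r_v`. -/
def UnderIllusion (G : Digraph V) (f : V → Color) (v : V) : Prop :=
  0 < deficiency G f v

/-- The `p`-deficiency `max {0, ⌈p * |N⁺(v)|⌉ - b_v}` (truncated subtraction). -/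
noncomputable def pDeficiency (p : ℚ) (G : Digraph V) (f : V → Color) (v : V) : ℕ :=
  ⌈p * ((outNbrs G v).ncard : ℚ)⌉₊ - blueCount G f v

/-- A vertex is under `p`-illusion if its `p`-deficiency is positive. -/
def UnderPIllusion (p : ℚ) (G : Digraph V) (f : V → Color) (v : V) : Prop :=
  0 < pDeficiency p G f v

/-- No vertex is under illusion. -/
def IllusionFree (G : Digraph V) (f : V → Color) : Prop :=
  ∀ v, ¬ UnderIllusion G f v

/-- No vertex is under `p`-illusion. -/
def PIllusionFree (p : ℚ) (G : Digraph V) (f : V → Color) : Prop :=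
  ∀ v, ¬ UnderPIllusion p G f v

/-- The number of vertices that are recoloured when passing from `f` to `f'`. -/
noncomputable def recolorCount (f f' : V → Color) : ℕ := {v | f v ≠ f' v}.ncard

/-- The decision problem DIFR. -/
def DIFR (G : Digraph V) (f : V → Color) (k : ℕ) : Prop :=
  ∃ f' : V → Color, IllusionFree G f' ∧ recolorCount f f' ≤ k

/-- The decision problem `p`-DIFR. -/
def PDIFR (p : ℚ) (G : Digraph V) (f : V → Color) (k : ℕ) : Prop :=
  ∃ f' : V → Color, PIllusionFree p G f' ∧ recolorCount f f' ≤ k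

/-- `f'` is a minimum illusion-free recolouring of `f`. -/
def IsMinRecoloring (G : Digraph V) (f f' : V → Color) : Prop :=
  IllusionFree G f' ∧ ∀ g : V → Color, IllusionFree G g → recolorCount f f' ≤ recolorCount f g

/-- `f'` is a minimum `p`-illusion-free recolouring of `f`. -/
def IsMinPRecoloring (p : ℚ) (G : Digraph V) (f f' : V → Color) : Prop :=
  PIllusionFree p G f' ∧
    ∀ g : V → Color, PIllusionFree p G g → recolorCount f f' ≤ recolorCount f g

/-! ### Outward grids -/

/-- The standard `m × n` outward grid: the out-neighbours of the vertex in row `i` and column `j`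
are its right neighbour `(i, j + 1)` and its lower neighbour `(i + 1, j)`. -/
def outwardGrid (m n : ℕ) : Digraph (Fin m × Fin n) where
  Adj x y :=
    ((y.1 : ℕ) = x.1 ∧ (y.2 : ℕ) = x.2 + 1) ∨ ((y.1 : ℕ) = x.1 + 1 ∧ (y.2 : ℕ) = x.2)

/-- `G` is an `m × n` outward grid, up to isomorphism of digraphs. -/
def IsOutwardGrid (m n : ℕ) (G : Digraph V) : Prop :=
  ∃ e : V ≃ Fin m × Fin n, ∀ u v, G.Adj u v ↔ (outwardGrid m n).Adj (e u) (e v)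

/-! ### The degree-one rule and the auxiliary graph -/

open Classical in
/-- Recolour all vertices of `S` blue. -/
noncomputable def paintBlue (f : V → Color) (S : Set V) : V → Color :=
  fun v => if v ∈ S then Color.blue else f v

/-- The colouring after exhaustive application of the degree-one rule: whenever a vertex `x` has
only one out-neighbour `v`, the vertex `v`, if red, is recoloured blue. -/
noncomputable def degreeOneRule (G : Digraph V) (f : V → Color) : V → Color :=
  paintBlue f {v | ∃ x, outNbrs G x = {v}}

/-- The auxiliary undirected graph on the red vertices of the colouring `f`: two red vertices are
joined when together they form the out-neighbourhood of a vertex under illusion. -/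
def auxGraph (G : Digraph V) (f : V → Color) : SimpleGraph {v : V // f v = Color.red} where
  Adj a b := a ≠ b ∧ ∃ x, UnderIllusion G f x ∧ outNbrs G x = {(a : V), (b : V)}
  symm := ⟨by
    rintro a b ⟨hab, x, hx, h⟩
    exact ⟨hab.symm, x, hx, by rw [h, Set.pair_comm]⟩⟩
  loopless := ⟨fun _ h => h.1 rfl⟩

/-- A vertex cover of minimum cardinality. -/
def IsMinVertexCover (H : SimpleGraph V) (S : Set V) : Prop :=
  H.IsVertexCover S ∧ ∀ T : Set V, H.IsVertexCover T → S.ncard ≤ T.ncard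

end Illusion

/-! ### A word RAM with unit-cost instructions -/

/-- Structured programs for a random access machine. Registers are numbered; a memory bank is
addressed indirectly, through the content of a register. A program mentions only finitely many
registers and finitely many banks. The only arithmetic is addition and truncated subtraction. -/
inductive Prog where
  /-- do nothing -/
  | skip
  /-- `r := c` -/
  | const (r c : ℕ)
  /-- `r := a` -/
  | copy (r a : ℕ)
  /-- `r := a + b` -/
  | add (r a b : ℕ)
  /-- `r := a - b`, truncated at `0` -/
  | sub (r a b : ℕ)
  /-- `r := B[i]`, where `B` is a memory bank and `i` a register -/
  | load (r B i : ℕ)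
  /-- `B[i] := a`, where `B` is a memory bank and `i`, `a` are registers -/
  | store (B i a : ℕ)
  /-- sequential composition -/
  | seq (P Q : Prog)
  /-- `if a < b then P else Q` -/
  | ifLt (a b : ℕ) (P Q : Prog)
  /-- `while a < b do P` -/
  | whileLt (a b : ℕ) (P : Prog)

/-- A memory state: the contents of the registers and of the memory banks. -/
@[ext] structure State where
  reg : ℕ → ℕ
  mem : ℕ → ℕ → ℕ

namespace State

/-- Write `x` into register `r`. -/
def setReg (s : State) (r x : ℕ) : State :=
  { s with reg := Function.update s.reg r x }

/-- Write `x` into cell `i` of bank `B`. -/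
def setMem (s : State) (B i x : ℕ) : State :=
  { s with mem := Function.update s.mem B (Function.update (s.mem B) i x) }

/-- The initial state: the input is written in bank `0` from address `0` on; everything else
is `0`. -/
def init (input : List ℕ) : State where
  reg := fun _ => 0
  mem := fun B i => if B = 0 then input.getD i 0 else 0

end State

/-- `Exec W P s s' t`: on a machine whose words hold the numbers `0, …, W`, the program `P`, started
in state `s`, halts in state `s'` after `t` steps. Every instruction and every evaluation of a test
costs one step. A run that would produce a number greater than `W` has no successor state. -/
inductive Exec (W : ℕ) : Prog → State → State → ℕ → Prop where
  | skip (s : State) : Exec W Prog.skip s s 1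
  | const (s : State) (r c : ℕ) (h : c ≤ W) : Exec W (Prog.const r c) s (s.setReg r c) 1
  | copy (s : State) (r a : ℕ) : Exec W (Prog.copy r a) s (s.setReg r (s.reg a)) 1
  | add (s : State) (r a b : ℕ) (h : s.reg a + s.reg b ≤ W) :
      Exec W (Prog.add r a b) s (s.setReg r (s.reg a + s.reg b)) 1
  | sub (s : State) (r a b : ℕ) :
      Exec W (Prog.sub r a b) s (s.setReg r (s.reg a - s.reg b)) 1
  | load (s : State) (r B i : ℕ) :
      Exec W (Prog.load r B i) s (s.setReg r (s.mem B (s.reg i))) 1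
  | store (s : State) (B i a : ℕ) :
      Exec W (Prog.store B i a) s (s.setMem B (s.reg i) (s.reg a)) 1
  | seq {P Q : Prog} {s s' s'' : State} {t t' : ℕ} (hP : Exec W P s s' t)
      (hQ : Exec W Q s' s'' t') : Exec W (Prog.seq P Q) s s'' (t + t')
  | ifTrue {a b : ℕ} {P Q : Prog} {s s' : State} {t : ℕ} (h : s.reg a < s.reg b)
      (hP : Exec W P s s' t) : Exec W (Prog.ifLt a b P Q) s s' (t + 1)
  | ifFalse {a b : ℕ} {P Q : Prog} {s s' : State} {t : ℕ} (h : ¬ s.reg a < s.reg b)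
      (hQ : Exec W Q s s' t) : Exec W (Prog.ifLt a b P Q) s s' (t + 1)
  | whileTrue {a b : ℕ} {P : Prog} {s s' s'' : State} {t t' : ℕ} (h : s.reg a < s.reg b)
      (hP : Exec W P s s' t) (hw : Exec W (Prog.whileLt a b P) s' s'' t') :
      Exec W (Prog.whileLt a b P) s s'' (t + t' + 1)
  | whileFalse {a b : ℕ} {P : Prog} {s : State} (h : ¬ s.reg a < s.reg b) :
      Exec W (Prog.whileLt a b P) s s 1

/-- On the given input, the program `P` halts after at most `T` steps in a state satisfying `post`,
as soon as the machine words can hold `C` times the length of the input and `C` times each of its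
entries. (So words of length `log₂ (input size) + O(1)` bits are enough.) -/
def Prog.RunsWithin (P : Prog) (C : ℕ) (input : List ℕ) (T : ℝ) (post : State → Prop) : Prop :=
  ∀ W : ℕ, C * input.length ≤ W → (∀ x ∈ input, C * x ≤ W) →
    ∃ (s : State) (t : ℕ), Exec W P (State.init input) s t ∧ (t : ℝ) ≤ T ∧ post s

/-- Register `0` of the final state holds the answer to the question `Q`: `1` for yes, `0` for
no. -/
def State.Answers (s : State) (Q : Prop) : Prop :=
  (Q → s.reg 0 = 1) ∧ (¬ Q → s.reg 0 = 0)

/-! ### Encoding of the instances -/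

section Encoding

variable {N : ℕ}

/-- `adj` lists, for every vertex, its out-neighbours in `G`, without repetition and in an
arbitrary order. -/
def IsAdjList (G : Digraph (Fin N)) (adj : Fin N → List (Fin N)) : Prop :=
  ∀ v, (adj v).Nodup ∧ ∀ u, u ∈ adj v ↔ G.Adj v u

/-- The colour of each vertex, followed by the adjacency lists: first the `N + 1` offsets (entry `v`
is the total length of the lists of the vertices `0, …, v - 1`), then the concatenation of the
lists. -/
def encodeNetwork (adj : Fin N → List (Fin N)) (f : Fin N → Color) : List ℕ :=
  List.ofFn (fun v => (f v).code)
    ++ (List.range (N + 1)).map (fun v => (((List.ofFn adj).take v).map List.length).sum)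
    ++ (List.ofFn adj).flatten.map (fun u => (u : ℕ))

/-- An instance of DIFR as a list of words: the number of vertices, `k`, and the network. -/
def encodeDIFR (adj : Fin N → List (Fin N)) (f : Fin N → Color) (k : ℕ) : List ℕ :=
  [N, k] ++ encodeNetwork adj f

/-- An instance of `p`-DIFR as a list of words: the number of vertices, `k`, the numerator and the
denominator of `p` (for `0 ≤ p`), and the network. -/
def encodePDIFR (p : ℚ) (adj : Fin N → List (Fin N)) (f : Fin N → Color) (k : ℕ) : List ℕ :=
  [N, k, p.num.toNat, p.den] ++ encodeNetwork adj f

/-- Bank `1` of the final state holds the colouring `f'`. -/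
def State.Outputs (s : State) (f' : Fin N → Color) : Prop :=
  ∀ v : Fin N, s.mem 1 v = (f' v).code

end Encoding

/-! ### Weakest preconditions and a rule for loops -/

namespace State

/-! A vertex of an outward grid has at most two out-neighbours, so being free of illusion is a local
condition (`Meets`): a vertex with one out-neighbour needs `c₁` blue ones, a vertex with two needs
`c₂`. For majority illusion `c₁ = c₂ = 1`; for `p`-illusion they are `⌈p⌉ ≤ 1` and `⌈2p⌉ ≤ 2`. A
condition that asks for all out-neighbours to be blue forces single vertices; a condition "one of
two" is an edge between them. Turning blue vertices red never helps, so the task is to keep a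
largest independent set of unforced red vertices, that is, to paint a minimum vertex cover blue.

The two out-neighbours of a vertex are its right and its lower neighbour, which lie in different
rows. A vertex is thus in at most one such pair as the upper member and in at most one as the lower
member (`IsOutwardGrid.exists_row`). Hence each vertex has at most one neighbour in a
higher-numbered row, and a vertex of smallest row among the non-isolated ones is a leaf
(`exists_leaf`). The same choice on a cycle gives acyclicity. If `c` is a leaf with neighbour `u`,
some maximum independent set avoids `u` (`exists_independent_erase`), so painting `u` blue is safe;
repeating this until no edge is left solves the problem (`NetData.Reduced`).

The program does this in linear time and needs no embedding: edges are read off the adjacency lists,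
and rows occur only in the proof. Each vertex stores its at most two neighbours in two slots. After
`u` is painted, only its other neighbour can become a new leaf among the vertices already passed, so
one sweep with this chasing suffices (`LeafMem.fire`, `LeafMem.advance`). The total `92 N + 80` lies
below the claimed bound because `mn ≥ 1`. -/

@[simp] theorem reg_setReg (s : State) (r x a : ℕ) :
    (s.setReg r x).reg a = if a = r then x else s.reg a := by
  simp [setReg, Function.update_apply]

@[simp] theorem mem_setReg (s : State) (r x : ℕ) : (s.setReg r x).mem = s.mem := rfl

@[simp] theorem reg_setMem (s : State) (B i x : ℕ) : (s.setMem B i x).reg = s.reg := rfl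

@[simp] theorem mem_setMem (s : State) (B i x C : ℕ) :
    (s.setMem B i x).mem C = if C = B then Function.update (s.mem B) i x else s.mem C := by
  simp only [setMem, Function.update_apply]

end State

namespace Prog

/-- The weakest precondition of a program without loops. -/
def wp (W : ℕ) : Prog → (State → Prop) → State → Prop
  | skip, Q, s => Q s
  | const r c, Q, s => c ≤ W ∧ Q (s.setReg r c)
  | copy r a, Q, s => Q (s.setReg r (s.reg a))
  | add r a b, Q, s => s.reg a + s.reg b ≤ W ∧ Q (s.setReg r (s.reg a + s.reg b))
  | sub r a b, Q, s => Q (s.setReg r (s.reg a - s.reg b))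
  | load r B i, Q, s => Q (s.setReg r (s.mem B (s.reg i)))
  | store B i a, Q, s => Q (s.setMem B (s.reg i) (s.reg a))
  | seq P R, Q, s => wp W P (wp W R Q) s
  | ifLt a b P R, Q, s =>
      (s.reg a < s.reg b → wp W P Q s) ∧ (¬ s.reg a < s.reg b → wp W R Q s)
  | whileLt _ _ _, _, _ => False

/-- A bound for the number of steps of a program without loops. -/
def cost : Prog → ℕ
  | seq P R => cost P + cost R
  | ifLt _ _ P R => cost P + cost R + 1
  | _ => 1

/-- Started in `s`, the program halts within `T` steps in a state satisfying `Q`. -/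
def Halts (W : ℕ) (P : Prog) (s : State) (T : ℕ) (Q : State → Prop) : Prop :=
  ∃ s' t, Exec W P s s' t ∧ t ≤ T ∧ Q s'

theorem wp_mono {W : ℕ} {P : Prog} {Q Q' : State → Prop} (hQ : ∀ s, Q s → Q' s) {s : State}
    (h : P.wp W Q s) : P.wp W Q' s := by
  induction P generalizing Q Q' s with
  | const | add => exact ⟨h.1, hQ _ h.2⟩
  | skip | copy | sub | load | store => exact hQ _ h
  | seq P R ihP ihR => exact ihP (fun s h => ihR hQ h) h
  | ifLt a b P R ihP ihR => exact ⟨fun hab => ihP hQ (h.1 hab), fun hab => ihR hQ (h.2 hab)⟩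
  | whileLt a b P => exact h

theorem halts_of_wp {W : ℕ} {P : Prog} {Q : State → Prop} {s : State} (h : P.wp W Q s) :
    P.Halts W s P.cost Q := by
  induction P generalizing Q s with
  | skip => exact ⟨_, _, .skip s, le_rfl, h⟩
  | const r c => exact ⟨_, _, .const s r c h.1, le_rfl, h.2⟩
  | copy r a => exact ⟨_, _, .copy s r a, le_rfl, h⟩
  | add r a b => exact ⟨_, _, .add s r a b h.1, le_rfl, h.2⟩
  | sub r a b => exact ⟨_, _, .sub s r a b, le_rfl, h⟩
  | load r B i => exact ⟨_, _, .load s r B i, le_rfl, h⟩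
  | store B i a => exact ⟨_, _, .store s B i a, le_rfl, h⟩
  | seq P R ihP ihR =>
    obtain ⟨s₁, t₁, e₁, l₁, h₁⟩ := ihP h
    obtain ⟨s₂, t₂, e₂, l₂, h₂⟩ := ihR h₁
    exact ⟨s₂, _, .seq e₁ e₂, Nat.add_le_add l₁ l₂, h₂⟩
  | ifLt a b P R ihP ihR =>
    by_cases hab : s.reg a < s.reg b
    · obtain ⟨s₁, t₁, e₁, l₁, h₁⟩ := ihP (h.1 hab)
      exact ⟨s₁, _, .ifTrue hab e₁, by simp only [cost]; omega, h₁⟩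
    · obtain ⟨s₁, t₁, e₁, l₁, h₁⟩ := ihR (h.2 hab)
      exact ⟨s₁, _, .ifFalse hab e₁, by simp only [cost]; omega, h₁⟩
  | whileLt a b P => exact h.elim

theorem Halts.seq {W : ℕ} {P R : Prog} {s : State} {T T' : ℕ} {Q Q' : State → Prop}
    (hP : P.Halts W s T Q) (hR : ∀ s', Q s' → R.Halts W s' T' Q') :
    (P.seq R).Halts W s (T + T') Q' := by
  obtain ⟨s₁, t₁, e₁, l₁, h₁⟩ := hP
  obtain ⟨s₂, t₂, e₂, l₂, h₂⟩ := hR s₁ h₁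
  exact ⟨s₂, _, .seq e₁ e₂, Nat.add_le_add l₁ l₂, h₂⟩

theorem Halts.mono {W : ℕ} {P : Prog} {s : State} {T T' : ℕ} {Q Q' : State → Prop}
    (hP : P.Halts W s T Q) (hT : T ≤ T') (hQ : ∀ s', Q s' → Q' s') : P.Halts W s T' Q' := by
  obtain ⟨s₁, t₁, e₁, l₁, h₁⟩ := hP
  exact ⟨s₁, t₁, e₁, l₁.trans hT, hQ _ h₁⟩

/-- A loop without inner loops, with an invariant `I` and a variant `φ`. -/
theorem halts_whileLt {W a b : ℕ} {P : Prog} (I : State → Prop) (φ : State → ℕ)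
    (h : ∀ s, I s → s.reg a < s.reg b → P.wp W (fun s' => I s' ∧ φ s' < φ s) s)
    (s : State) (hs : I s) :
    (whileLt a b P).Halts W s ((P.cost + 1) * φ s + 1)
      (fun s' => I s' ∧ s'.reg b ≤ s'.reg a) := by
  induction hn : φ s using Nat.strong_induction_on generalizing s with
  | _ n ih =>
    subst hn
    by_cases hab : s.reg a < s.reg b
    · obtain ⟨s₁, t₁, e₁, l₁, h₁, hφ⟩ := halts_of_wp (h s hs hab)
      obtain ⟨s₂, t₂, e₂, l₂, h₂⟩ := ih _ hφ s₁ h₁ rfl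
      refine ⟨s₂, _, .whileTrue hab e₁ e₂, ?_, h₂⟩
      -- The variant drops by at least one, which pays for one body and one test.
      have := Nat.mul_le_mul_left (P.cost + 1) (Nat.succ_le_of_lt hφ)
      rw [Nat.succ_eq_add_one, mul_add] at this
      omega
    · exact ⟨s, 1, .whileFalse hab, by omega, hs, not_lt.1 hab⟩

end Prog

/-! ### Maximum independent sets and the leaf rule -/

/-- If all red neighbours of the red vertex `c` are equal to `u`, then `u` may be given up: each
independent set of red vertices can be exchanged for one without `u` that is not smaller. -/
theorem exists_independent_erase {α : Type*} [DecidableEq α] {E : α → α → Prop}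
    (symm : ∀ a b, E a b → E b a) (irrefl : ∀ a, ¬ E a a)
    {R I : Finset α} {c u : α} (hc : c ∈ R) (hcu : E c u) (hleaf : ∀ w ∈ R, E c w → w = u)
    (hI : I ⊆ R) (ind : ∀ a ∈ I, ∀ b ∈ I, ¬ E a b) :
    ∃ J ⊆ R.erase u, (∀ a ∈ J, ∀ b ∈ J, ¬ E a b) ∧ I.card ≤ J.card := by
  by_cases hu : u ∈ I
  · have hne : c ≠ u := by rintro rfl; exact irrefl _ hcu
    have hcI : c ∉ I := fun h => ind c h u hu hcu
    -- Trade `u` for `c`: the only neighbour of `c` in `R` has just left.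
    refine ⟨insert c (I.erase u), ?_, ?_, ?_⟩
    · intro a ha
      simp only [Finset.mem_insert, Finset.mem_erase] at ha ⊢
      rcases ha with rfl | ha
      · exact ⟨hne, hc⟩
      · exact ⟨ha.1, hI ha.2⟩
    · intro a ha b hb hab
      simp only [Finset.mem_insert, Finset.mem_erase] at ha hb
      rcases ha with rfl | ha <;> rcases hb with rfl | hb
      · exact irrefl _ hab
      · exact hb.1 (hleaf b (hI hb.2) hab)
      · exact ha.1 (hleaf a (hI ha.2) (symm _ _ hab))
      · exact ind a ha.2 b hb.2 hab
    · rw [Finset.card_insert_of_notMem (by simp [hcI]), Finset.card_erase_add_one hu]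
  · exact ⟨I, fun a ha => Finset.mem_erase.2 ⟨by rintro rfl; exact hu ha, hI ha⟩, ind, le_rfl⟩

/-- A finite graph with edges in which adjacent vertices differ in height, and each vertex has at
most one neighbour above it, has a leaf. -/
theorem exists_leaf {α : Type*} {E : α → α → Prop} (symm : ∀ a b, E a b → E b a)
    (row : α → ℕ) (hrow : ∀ a b, E a b → row b ≠ row a)
    (huniq : ∀ a b c, E a b → E a c → row a < row b → row a < row c → b = c)
    {R : Finset α} {a b : α} (ha : a ∈ R) (hb : b ∈ R) (hab : E a b) :
    ∃ c ∈ R, ∃ u ∈ R, E c u ∧ ∀ w ∈ R, E c w → w = u := by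
  classical
  -- Among the vertices of `R` with a neighbour in `R`, take one of least height: all its neighbours
  -- there lie above it, so there is only one.
  obtain ⟨c, hc, hmin⟩ := Finset.exists_min_image (R.filter fun c => ∃ u ∈ R, E c u) row
    ⟨a, Finset.mem_filter.2 ⟨ha, b, hb, hab⟩⟩
  obtain ⟨hcR, u, hu, hcu⟩ := Finset.mem_filter.1 hc
  have key : ∀ w ∈ R, E c w → row c < row w := fun w hw h =>
    lt_of_le_of_ne (hmin w (Finset.mem_filter.2 ⟨hw, c, hcR, symm _ _ h⟩)) (hrow _ _ h).symm
  exact ⟨c, hcR, u, hu, hcu, fun w hw h => huniq _ _ _ h hcu (key w hw h) (key u hu hcu)⟩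

/-- `p` and `q` are the at most two elements of `S`, where `0` stands for no element. -/
structure IsSlots (p q : ℕ) (S : ℕ → Prop) : Prop where
  mem_iff : ∀ b, S b ↔ b ≠ 0 ∧ (b = p ∨ b = q)
  right_eq_zero : p = 0 → q = 0
  ne_of_ne_zero : p ≠ 0 → p ≠ q

theorem IsSlots.congr {p q : ℕ} {S S' : ℕ → Prop} (h : IsSlots p q S) (hS : ∀ b, S' b ↔ S b) :
    IsSlots p q S' := by
  rwa [funext fun b => propext (hS b)]

theorem IsSlots.insert_left {q b : ℕ} {S S' : ℕ → Prop} (h : IsSlots 0 q S) (hb : b ≠ 0)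
    (hS' : ∀ a, S' a ↔ S a ∨ a = b) : IsSlots b q S' := by
  have hq := h.right_eq_zero rfl
  subst hq
  refine ⟨fun a => ?_, fun h => absurd h hb, fun _ => hb⟩
  rw [hS', h.mem_iff]
  constructor
  · rintro (⟨h0, h1⟩ | rfl)
    · simp_all
    · exact ⟨hb, .inl rfl⟩
  · rintro ⟨h0, h1 | h1⟩
    · exact .inr h1
    · exact absurd h1 h0

/-- By `htwo` there was at most one element, and it occupies `p`; so the second slot is still empty
and nothing is overwritten. -/
theorem IsSlots.insert_right {p q b : ℕ} {S S' : ℕ → Prop} (h : IsSlots p q S) (hp : p ≠ 0)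
    (hb : b ≠ 0) (hbS : ¬ S b) (hS' : ∀ a, S' a ↔ S a ∨ a = b)
    (htwo : ∀ a c, S a → S c → a = c) : IsSlots p b S' := by
  have hq : q = 0 := by
    by_contra hq
    exact h.ne_of_ne_zero hp (htwo _ _ ((h.mem_iff p).2 ⟨hp, .inl rfl⟩)
      ((h.mem_iff q).2 ⟨hq, .inr rfl⟩))
  subst hq
  refine ⟨fun a => ?_, fun h => absurd h hp, ?_⟩
  · rw [hS', h.mem_iff]
    constructor
    · rintro (⟨h0, h1 | h1⟩ | rfl)
      · exact ⟨h0, .inl h1⟩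
      · exact absurd h1 h0
      · exact ⟨hb, .inr rfl⟩
    · rintro ⟨h0, h1 | h1⟩
      · exact .inl ⟨h0, .inl h1⟩
      · exact .inr h1
  · rintro _ rfl
    exact hbS ((h.mem_iff p).2 ⟨hp, .inl rfl⟩)

/-! ### The algorithm -/

/-- The data of a network as the machine sees it, with vertices numbered from `1` to `N`. The word
size is `W`, the input occupies the bank `inp`, `nbrs x` is the list of the out-neighbours of the
`x`-th vertex, and a vertex with `d` out-neighbours needs `d` blue out-neighbours at least `need₁`
or `need₂` many if `d = 1` or `d = 2`. -/
structure NetData (W : ℕ) where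
  N : ℕ
  k : ℕ
  base : ℕ
  need₁ : ℕ
  need₂ : ℕ
  nbrs : ℕ → List ℕ
  reds : Finset ℕ
  inp : ℕ → ℕ
  off : ℕ → ℕ
  row : ℕ → ℕ
  length_le : ∀ x, (nbrs x).length ≤ 2
  nodup : ∀ x, (nbrs x).Nodup
  mem_nbrs : ∀ x, ∀ a ∈ nbrs x, 1 ≤ a ∧ a ≤ N
  mem_reds : ∀ a ∈ reds, 1 ≤ a ∧ a ≤ N
  inp_color : ∀ v < N, inp (base + v) = if v + 1 ∈ reds then 1 else 0
  inp_off : ∀ x ≤ N, inp (base + N + x) = off x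
  off_succ : ∀ x < N, off (x + 1) = off x + (nbrs x).length
  inp_nbrs : ∀ x < N, ∀ (j : ℕ) (h : j < (nbrs x).length),
    inp (base + N + N + 1 + off x + j) + 1 = (nbrs x)[j]
  le_word : base + N + N + 1 + off N ≤ W
  four_le : 4 ≤ W
  row_ne : ∀ x a b, nbrs x = [a, b] ∨ nbrs x = [b, a] → row b ≠ row a
  unique : ∀ x y a b c, nbrs x = [a, b] ∨ nbrs x = [b, a] → nbrs y = [a, c] ∨ nbrs y = [c, a] →
    (row a < row b ↔ row a < row c) → b = c ∧ x = y

namespace NetData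

variable {W : ℕ} (D : NetData W)

/-- Two vertices are the out-neighbours of one of the first `i` vertices, one of them blue. -/
def Edge (i a b : ℕ) : Prop :=
  D.need₂ = 1 ∧ ∃ x < i, D.nbrs x = [a, b] ∨ D.nbrs x = [b, a]

/-- A vertex has to be blue because of one of the first `i` vertices alone. -/
def Forced (i a : ℕ) : Prop :=
  ∃ x < i, a ∈ D.nbrs x ∧
    ((D.nbrs x).length = 1 ∧ 0 < D.need₁ ∨ (D.nbrs x).length = 2 ∧ 1 < D.need₂)

theorem Edge.symm {D : NetData W} {i a b : ℕ} (h : D.Edge i a b) : D.Edge i b a := by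
  obtain ⟨h1, x, hx, h⟩ := h
  exact ⟨h1, x, hx, h.symm⟩

theorem Edge.row_ne {D : NetData W} {i a b : ℕ} (h : D.Edge i a b) : D.row b ≠ D.row a := by
  obtain ⟨h1, x, hx, h⟩ := h
  exact D.row_ne x a b h

theorem Edge.unique {D : NetData W} {i a b c : ℕ} (h : D.Edge i a b) (h' : D.Edge i a c)
    (hr : D.row a < D.row b ↔ D.row a < D.row c) : b = c := by
  obtain ⟨h1, x, hx, h⟩ := h
  obtain ⟨h1, y, hy, h'⟩ := h'
  exact (D.unique x y a b c h h' hr).1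

theorem Edge.irrefl {D : NetData W} {i a : ℕ} : ¬ D.Edge i a a := fun h => h.row_ne rfl

theorem Edge.mem {D : NetData W} {i a b : ℕ} (h : D.Edge i a b) : 1 ≤ a ∧ a ≤ D.N := by
  obtain ⟨h1, x, hx, h | h⟩ := h <;> exact D.mem_nbrs x a (by simp [h])

theorem edge_zero (a b : ℕ) : ¬ D.Edge 0 a b := by simp [Edge]

theorem forced_zero (a : ℕ) : ¬ D.Forced 0 a := by simp [Forced]

theorem edge_succ (i a b : ℕ) : D.Edge (i + 1) a b ↔
    D.Edge i a b ∨ D.need₂ = 1 ∧ (D.nbrs i = [a, b] ∨ D.nbrs i = [b, a]) := by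
  simp only [Edge, Nat.lt_succ_iff_lt_or_eq]
  constructor
  · rintro ⟨h, x, hx | rfl, h'⟩
    · exact .inl ⟨h, x, hx, h'⟩
    · exact .inr ⟨h, h'⟩
  · rintro (⟨h, x, hx, h'⟩ | ⟨h, h'⟩)
    · exact ⟨h, x, .inl hx, h'⟩
    · exact ⟨h, i, .inr rfl, h'⟩

theorem forced_succ (i a : ℕ) : D.Forced (i + 1) a ↔ D.Forced i a ∨ a ∈ D.nbrs i ∧
    ((D.nbrs i).length = 1 ∧ 0 < D.need₁ ∨ (D.nbrs i).length = 2 ∧ 1 < D.need₂) := by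
  simp only [Forced, Nat.lt_succ_iff_lt_or_eq]
  constructor
  · rintro ⟨x, hx | rfl, h'⟩
    · exact .inl ⟨x, hx, h'⟩
    · exact .inr h'
  · rintro (⟨x, hx, h'⟩ | h')
    · exact ⟨x, .inl hx, h'⟩
    · exact ⟨i, .inr rfl, h'⟩

/-- A set of vertices may be the set of red vertices of a colouring without illusion. -/
def Admissible (I : Finset ℕ) : Prop :=
  (∀ a ∈ I, ¬ D.Forced D.N a) ∧ ∀ a ∈ I, ∀ b ∈ I, ¬ D.Edge D.N a b

theorem off_le {x : ℕ} (hx : x ≤ D.N) : D.off x ≤ D.off D.N := by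
  suffices ∀ d x, x + d = D.N → D.off x ≤ D.off D.N from this (D.N - x) x (by omega)
  intro d
  induction d with
  | zero => rintro x rfl; exact le_rfl
  | succ d ih =>
    intro x h
    have := ih (x + 1) (by omega)
    have := D.off_succ x (by omega)
    omega

/-- The registers that stay constant during the computation. -/
structure Ctx (s : State) : Prop where
  r0 : s.reg 0 = 0
  r1 : s.reg 1 = D.N
  r2 : s.reg 2 = D.k
  r3 : s.reg 3 = 1
  r4 : s.reg 4 = D.base
  r5 : s.reg 5 = D.base + D.N
  r6 : s.reg 6 = D.base + D.N + D.N + 1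
  r7 : s.reg 7 = D.need₁
  r8 : s.reg 8 = D.need₂
  m0 : s.mem 0 = D.inp

variable {D}

theorem Ctx.setReg {s : State} (h : D.Ctx s) {r : ℕ} (hr : 9 ≤ r) (x : ℕ) :
    D.Ctx (s.setReg r x) := by
  constructor <;> simp only [State.reg_setReg, State.mem_setReg] <;>
    first | exact h.m0 | (rw [if_neg (by omega)]; first
      | exact h.r0 | exact h.r1 | exact h.r2 | exact h.r3 | exact h.r4 | exact h.r5 | exact h.r6
      | exact h.r7 | exact h.r8)

theorem Ctx.setMem {s : State} (h : D.Ctx s) {B : ℕ} (hB : B ≠ 0) (i x : ℕ) :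
    D.Ctx (s.setMem B i x) := by
  obtain ⟨r0, r1, r2, r3, r4, r5, r6, r7, r8, m0⟩ := h
  exact ⟨r0, r1, r2, r3, r4, r5, r6, r7, r8, by simpa [hB.symm] using m0⟩

end NetData

/-! ### The programs -/

namespace Prog

/-- Copy the colours into bank `4`, shifted by one. -/
def copyColors : Prog :=
  whileLt 9 1 <|
    (add 10 4 9).seq <| (load 11 0 10).seq <| (add 9 9 3).seq <| store 4 9 11

/-- Enter the content of register `b` into the slots of the vertex in register `a`. -/
def insertSlot (a b : ℕ) : Prog :=
  (load 15 2 a).seq <| ifLt 0 15 (store 3 a b) (store 2 a b)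

/-- The body of the loop that scans the adjacency lists. -/
def scanBody : Prog :=
  (add 10 5 9).seq <| (load 11 0 10).seq <| (add 10 10 3).seq <| (load 12 0 10).seq <|
  (sub 12 12 11).seq <|
  (ifLt 0 12
    ((add 10 6 11).seq <| (load 13 0 10).seq <| (add 13 13 3).seq <|
      ifLt 3 12
        ((add 10 10 3).seq <| (load 14 0 10).seq <| (add 14 14 3).seq <|
          ifLt 3 8 ((store 4 13 0).seq (store 4 14 0))
            (ifLt 0 8 ((insertSlot 13 14).seq (insertSlot 14 13)) skip))
        (ifLt 0 7 (store 4 13 0) skip))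
    skip).seq <|
  add 9 9 3

/-- Scan the adjacency lists: recolour the forced vertices, and fill the slots of each vertex. -/
def scan : Prog := (const 9 0).seq <| whileLt 9 1 scanBody

/-- The body of the loop of the leaf rule. -/
def leafBody : Prog :=
  (load 11 4 10).seq <| (load 12 2 10).seq <| (load 13 3 10).seq <|
  (load 14 4 12).seq <| (load 15 4 13).seq <| (const 16 0).seq <|
  (ifLt 0 11 (ifLt 15 14 (copy 16 12) (ifLt 14 15 (copy 16 13) skip)) skip).seq <|
  ifLt 0 16
    ((store 4 16 0).seq <| (load 12 2 16).seq <| (load 13 3 16).seq <|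
      (add 12 12 13).seq <| sub 10 12 10)
    ((add 9 9 3).seq <| copy 10 9)

/-- The leaf rule: as long as there is a red vertex with a single red neighbour, recolour that
neighbour. -/
def leafRule : Prog :=
  (copy 9 3).seq <| (copy 10 3).seq <| (add 20 1 3).seq <| whileLt 9 20 leafBody

/-- Write the colouring into bank `1` and count the changes in register `16`. -/
def outputBody : Prog :=
  (add 10 4 9).seq <| (load 11 0 10).seq <| (add 12 9 3).seq <| (load 13 4 12).seq <|
  (store 1 9 13).seq <| (sub 11 11 13).seq <| (add 16 16 11).seq <| add 9 9 3

/-- Write the output and answer the decision problem. -/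
def output : Prog :=
  (const 9 0).seq <| (const 16 0).seq <| (whileLt 9 1 outputBody).seq <|
    ifLt 2 16 (const 0 0) (const 0 1)

/-- The algorithm, after the preparation of the registers `1` to `8`. -/
def main : Prog := copyColors.seq <| scan.seq <| leafRule.seq output

end Prog

/-! ### Correctness and step counts of the programs -/

namespace NetData

open Prog

variable {W : ℕ} {D : NetData W}

/-- The counter is raised before the store, so the colour of the `v`-th input vertex lands in cell
`v + 1`. Cell `0` stays `0`: an empty slot reads as "not red". -/
theorem halts_copyColors {s : State} (hs : D.Ctx s) (h9 : s.reg 9 = 0)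
    (hm : ∀ B, B ≠ 0 → ∀ i, s.mem B i = 0) :
    copyColors.Halts W s (5 * D.N + 1) fun s => D.Ctx s ∧ (∀ i, s.mem 2 i = 0) ∧
      (∀ i, s.mem 3 i = 0) ∧ ∀ a, s.mem 4 a = if a ∈ D.reds then 1 else 0 := by
  refine (halts_whileLt (W := W) (fun s => D.Ctx s ∧ s.reg 9 ≤ D.N ∧ (∀ i, s.mem 2 i = 0) ∧
      (∀ i, s.mem 3 i = 0) ∧ ∀ a, s.mem 4 a = if a ∈ D.reds ∧ a ≤ s.reg 9 then 1 else 0)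
      (fun s => D.N - s.reg 9) ?_ s ⟨hs, by omega, hm 2 (by simp), hm 3 (by simp), ?_⟩).mono ?_ ?_
  · rintro s ⟨hs, h9, h2, h3, h4⟩ hlt
    rw [hs.r1] at hlt
    have hW := D.le_word
    have hc := D.inp_color _ hlt
    simp only [wp, State.reg_setReg, State.mem_setReg, State.mem_setMem, State.reg_setMem,
      hs.r4, hs.r3, hs.m0]
    norm_num
    refine ⟨by omega, by omega, ⟨?_, by omega, h2, h3, fun a => ?_⟩, by omega⟩
    · exact (((hs.setReg (by norm_num) _).setReg (by norm_num) _).setReg (by norm_num) _).setMem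
        (by norm_num) _ _
    · rw [Function.update_apply, h4]
      split_ifs with h h' h'
      · subst h
        simp only [hc, h'.1, if_true]
      · subst h
        simp only [hc]
        rw [if_neg (fun h => h' ⟨h, le_rfl⟩)]
      all_goals grind
  · intro a
    rw [hm 4 (by simp), if_neg]
    rintro ⟨h, h'⟩
    have := D.mem_reds a h
    omega
  · simp only [cost]
    omega
  · rintro s ⟨⟨hs, h9, h2, h3, h4⟩, hlt⟩
    refine ⟨hs, h2, h3, fun a => ?_⟩
    rw [hs.r1] at hlt
    rw [h4]
    have := D.mem_reds a
    grind

/-- The contents of the banks `2`, `3` and `4` after the scan of `i` adjacency lists. -/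
structure ScanMem (D : NetData W) (i : ℕ) (m₂ m₃ m₄ : ℕ → ℕ) : Prop where
  le_one : ∀ a, m₄ a ≤ 1
  color : ∀ a, m₄ a = 1 ↔ a ∈ D.reds ∧ ¬ D.Forced i a
  slots : ∀ a, IsSlots (m₂ a) (m₃ a) (D.Edge i a)

/-- The effect of `insertSlot` on the two banks. Since `a` has at most one earlier neighbour and `b`
is not it, a free slot exists and no entry is repeated. -/
theorem isSlots_insert {m₂ m₃ : ℕ → ℕ} {E E' : ℕ → ℕ → Prop} {a b : ℕ}
    (h : ∀ v, IsSlots (m₂ v) (m₃ v) (E v)) (hb : b ≠ 0) (hab : ¬ E a b)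
    (htwo : ∀ c c', E a c → E a c' → c = c')
    (hE' : ∀ x y, E' x y ↔ E x y ∨ x = a ∧ y = b) (v : ℕ) :
    IsSlots ((if m₂ a = 0 then Function.update m₂ a b else m₂) v)
      ((if m₂ a = 0 then m₃ else Function.update m₃ a b) v) (E' v) := by
  by_cases hv : v = a
  · subst hv
    by_cases h0 : m₂ v = 0
    · simp only [h0, if_true, Function.update_self]
      have := h v
      rw [h0] at this
      exact this.insert_left hb (by simpa using hE' v)
    · simp only [h0, if_false, Function.update_self]
      exact (h v).insert_right h0 hb hab (by simpa using hE' v) htwo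
  · have : IsSlots (m₂ v) (m₃ v) (E' v) := (h v).congr (by simp [hE', hv])
    split_ifs <;> simpa [hv] using this

theorem ScanMem.of_no_effect {i : ℕ} {m₂ m₃ m₄ : ℕ → ℕ} (h : D.ScanMem i m₂ m₃ m₄)
    (h₁ : (D.nbrs i).length = 1 → D.need₁ = 0) (h₂ : (D.nbrs i).length = 2 → D.need₂ = 0) :
    D.ScanMem (i + 1) m₂ m₃ m₄ := by
  refine ⟨h.le_one, fun a => ?_, fun a => (h.slots a).congr fun b => ?_⟩
  · rw [h.color, forced_succ]
    grind
  · rw [edge_succ]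
    refine or_iff_left ?_
    rintro ⟨h1, h3 | h3⟩ <;> · rw [h3] at h₂; simp [h1] at h₂

theorem ScanMem.of_forced {i : ℕ} {m₂ m₃ m₄ m₄' : ℕ → ℕ} (h : D.ScanMem i m₂ m₃ m₄)
    (hi : (D.nbrs i).length = 1 ∧ 0 < D.need₁ ∨ (D.nbrs i).length = 2 ∧ 1 < D.need₂)
    (hm : ∀ a, m₄' a = if a ∈ D.nbrs i then 0 else m₄ a) :
    D.ScanMem (i + 1) m₂ m₃ m₄' := by
  refine ⟨fun a => ?_, fun a => ?_, fun a => (h.slots a).congr fun b => ?_⟩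
  · rw [hm]
    have := h.le_one a
    split_ifs <;> omega
  · rw [hm, forced_succ]
    have := h.color a
    split_ifs <;> grind
  · rw [edge_succ]
    refine or_iff_left ?_
    rintro ⟨h1, h3 | h3⟩ <;> · rw [h3] at hi; simp [h1] at hi

/-- The edge is entered at both of its ends; the primed banks are those after the first insertion,
the doubly primed ones those after the second. -/
theorem ScanMem.of_edge {i a b : ℕ} {m₂ m₃ m₄ m₂' m₃' m₂'' m₃'' : ℕ → ℕ}
    (h : D.ScanMem i m₂ m₃ m₄) (hi : D.nbrs i = [a, b]) (hn : D.need₂ = 1)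
    (h₂ : m₂' = if m₂ a = 0 then Function.update m₂ a b else m₂)
    (h₃ : m₃' = if m₂ a = 0 then m₃ else Function.update m₃ a b)
    (h₂' : m₂'' = if m₂' b = 0 then Function.update m₂' b a else m₂')
    (h₃' : m₃'' = if m₂' b = 0 then m₃' else Function.update m₃' b a) :
    D.ScanMem (i + 1) m₂'' m₃'' m₄ := by
  have ha := D.mem_nbrs i a (by simp [hi])
  have hb := D.mem_nbrs i b (by simp [hi])
  have hab : a ≠ b := by simpa [hi] using D.nodup i
  have key : ∀ a b, (D.nbrs i = [a, b] ∨ D.nbrs i = [b, a]) →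
      ¬ D.Edge i a b ∧ ∀ c c', D.Edge i a c → D.Edge i a c' → c = c' := by
    intro a b hi
    -- An earlier edge at `a` on the same side as `b` would come from the same vertex `i`, by
    -- `unique`. So all earlier neighbours of `a` are on the other side, where there is room for
    -- one.
    have h1 : ∀ c, D.Edge i a c → ¬ (D.row a < D.row b ↔ D.row a < D.row c) := by
      rintro c ⟨-, x, hx, h⟩ hr
      exact hx.ne (D.unique i x a b c hi h hr).2.symm
    refine ⟨fun h => h1 b h Iff.rfl, fun c c' h h' => ?_⟩
    have := h1 c h
    have := h1 c' h'
    exact Edge.unique h h' (by tauto)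
  obtain ⟨ka, ka'⟩ := key a b (.inl hi)
  obtain ⟨kb, kb'⟩ := key b a (.inr hi)
  refine ⟨h.le_one, fun c => ?_, ?_⟩
  · rw [h.color, forced_succ]
    simp [hi, hn]
  · have s1 := isSlots_insert (E' := fun x y => D.Edge i x y ∨ x = a ∧ y = b) h.slots
      (by omega) ka ka' (fun x y => Iff.rfl)
    rw [← h₂, ← h₃] at s1
    -- The first insertion touched only the slots of `a ≠ b`, so those of `b` still satisfy the
    -- hypotheses.
    have s2 := isSlots_insert (E' := D.Edge (i + 1)) (a := b) (b := a) s1 (by omega)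
      (by rintro (h | h); exacts [kb h, hab h.2]) ?_ ?_
    · rwa [← h₂', ← h₃'] at s2
    · rintro c c' (h | h) (h' | h')
      · exact kb' _ _ h h'
      · exact absurd h'.1.symm hab
      · exact absurd h.1.symm hab
      · exact absurd h.1.symm hab
    · intro x y
      rw [edge_succ, hi]
      simp only [hn, true_and, List.cons.injEq, and_true]
      grind

/-- The postcondition is passed as a continuation, so that two insertions can be chained inside the
scan. -/
theorem wp_insertSlot {Q : State → Prop} {s : State} {a b : ℕ} (hs : D.Ctx s) (ha : a ≠ 15)
    (hb : b ≠ 15)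
    (h : ∀ s', D.Ctx s' → (∀ r, r ≠ 15 → s'.reg r = s.reg r) → s'.mem 4 = s.mem 4 →
      s'.mem 2 = (if s.mem 2 (s.reg a) = 0 then
        Function.update (s.mem 2) (s.reg a) (s.reg b) else s.mem 2) →
      s'.mem 3 = (if s.mem 2 (s.reg a) = 0 then s.mem 3 else
        Function.update (s.mem 3) (s.reg a) (s.reg b)) → Q s') :
    (insertSlot a b).wp W Q s := by
  simp only [insertSlot, wp, State.reg_setReg, ha, hb, if_false, if_true]
  norm_num [hs.r0]
  constructor <;> intro h0 <;> apply h
  · exact (hs.setReg (by norm_num) _).setMem (by norm_num) _ _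
  · intro r hr
    simp [hr]
  · simp
  · simp [h0.ne']
  · simp [h0.ne']
  · exact (hs.setReg (by norm_num) _).setMem (by norm_num) _ _
  · intro r hr
    simp [hr]
  · simp
  · simp [h0]
  · simp [h0]

theorem wp_scanBody {s : State} (hs : D.Ctx s) (h9 : s.reg 9 < D.N)
    (hm : D.ScanMem (s.reg 9) (s.mem 2) (s.mem 3) (s.mem 4)) :
    scanBody.wp W (fun s' => (D.Ctx s' ∧ s'.reg 9 ≤ D.N ∧
      D.ScanMem (s'.reg 9) (s'.mem 2) (s'.mem 3) (s'.mem 4)) ∧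
      D.N - s'.reg 9 < D.N - s.reg 9) s := by
  have hW := D.le_word
  have hW4 := D.four_le
  have hoff := D.inp_off _ h9.le
  have hoff' := D.inp_off _ (Nat.succ_le_of_lt h9)
  have hsucc := D.off_succ _ h9
  have hle := D.off_le (Nat.succ_le_of_lt h9)
  have hnb := D.inp_nbrs _ h9
  have hlen := D.length_le (s.reg 9)
  have hmem := D.mem_nbrs (s.reg 9)
  rw [Nat.succ_eq_add_one] at hoff' hle
  rw [← add_assoc] at hoff'
  generalize hi : s.reg 9 = i at *
  -- The degree decides the branch. In degree two, `need₂` separates painting both, entering an edge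
  -- and doing nothing.
  rcases hL : D.nbrs i with _ | ⟨a, _ | ⟨b, _ | ⟨c, l⟩⟩⟩
  · simp only [hL, List.length_nil, add_zero] at hsucc
    simp only [scanBody, wp, State.reg_setReg, State.mem_setReg, State.mem_setMem,
      State.reg_setMem, hs.r5, hs.r3, hs.r0, hs.m0, hi, reduceIte]
    norm_num [hoff, hoff', hsucc]
    refine ⟨by omega, by omega, by omega, ⟨?_, by omega, ?_⟩, by omega⟩
    · repeat (first | exact hs | refine Ctx.setReg ?_ (by norm_num) _)
    · exact hm.of_no_effect (by simp [hL]) (by simp [hL])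
  · simp only [hL, List.length_singleton] at hsucc hnb
    have ha := hnb 0 (by simp)
    simp only [add_zero, List.getElem_cons_zero] at ha
    have haN := hmem a (by simp [hL])
    simp only [scanBody, wp, State.reg_setReg, State.mem_setReg, State.mem_setMem,
      State.reg_setMem, hs.r5, hs.r6, hs.r3, hs.r0, hs.m0, hs.r7, hi, reduceIte]
    norm_num [hoff, hoff', hsucc, ha]
    refine ⟨by omega, by omega, by omega, by omega, ?_, ?_⟩
    · refine fun hn => ⟨by omega, ⟨?_, by omega, ?_⟩, by omega⟩
      · repeat (first | exact hs | refine Ctx.setReg ?_ (by norm_num) _ |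
          refine Ctx.setMem ?_ (by norm_num) _ _)
      · refine hm.of_forced (by simp [hL, hn]) fun c => ?_
        simp [hL, Function.update_apply]
    · refine fun hn => ⟨by omega, ⟨?_, by omega, ?_⟩, by omega⟩
      · repeat (first | exact hs | refine Ctx.setReg ?_ (by norm_num) _)
      · exact hm.of_no_effect (by simp [hn]) (by simp [hL])
  · simp only [hL, List.length_cons, List.length_nil, zero_add] at hsucc hnb
    have ha := hnb 0 (by simp)
    have hb := hnb 1 (by simp)
    simp only [add_zero, List.getElem_cons_zero, List.getElem_cons_succ] at ha hb
    have haN := hmem a (by simp [hL])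
    have hbN := hmem b (by simp [hL])
    have hab : a ≠ b := by simpa [hL] using D.nodup i
    simp only [scanBody, wp, State.reg_setReg, State.mem_setReg, State.mem_setMem,
      State.reg_setMem, hs.r5, hs.r6, hs.r3, hs.r0, hs.m0, hs.r8, hi, reduceIte]
    norm_num [hoff, hoff', hsucc, ha, hb]
    refine ⟨by omega, by omega, by omega, by omega, by omega, by omega, ?_, fun hn =>
      ⟨fun hn' => ?_, ?_⟩⟩
    · refine fun hn => ⟨by omega, ⟨?_, by omega, ?_⟩, by omega⟩
      · repeat (first | exact hs | refine Ctx.setReg ?_ (by norm_num) _ |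
          refine Ctx.setMem ?_ (by norm_num) _ _)
      · refine hm.of_forced (by simp [hL, hn]) fun c => ?_
        simp only [hL, Function.update_apply, List.mem_cons, List.not_mem_nil, or_false]
        split_ifs <;> first | rfl | tauto
    · refine wp_insertSlot (D := D) ?_ (by norm_num) (by norm_num) ?_
      · repeat (first | exact hs | refine Ctx.setReg ?_ (by norm_num) _)
      norm_num
      intro s₁ hs₁ hr₁ h4 h2 h3
      refine wp_insertSlot hs₁ (by norm_num) (by norm_num) ?_
      intro s₂ hs₂ hr₂ h4' h2' h3'
      rw [hr₁ 14 (by norm_num), hr₁ 13 (by norm_num)] at h2' h3'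
      norm_num at h2' h3'
      have hr : s₂.reg 9 = i := by
        rw [hr₂ 9 (by norm_num), hr₁ 9 (by norm_num)]
        norm_num [hi]
      rw [hs₂.r3, hr]
      refine ⟨by omega, ⟨hs₂.setReg (by norm_num) _, by omega, ?_⟩, by omega⟩
      rw [h4', h4]
      exact hm.of_edge hL (by omega) h2 h3 h2' h3'
    · refine fun hn => ⟨by omega, ⟨?_, by omega, ?_⟩, by omega⟩
      · repeat (first | exact hs | refine Ctx.setReg ?_ (by norm_num) _)
      · exact hm.of_no_effect (by simp [hL]) (by simp [hn])
  · simp [hL] at hlen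

theorem halts_scan {s : State} (hs : D.Ctx s) (h2 : ∀ i, s.mem 2 i = 0) (h3 : ∀ i, s.mem 3 i = 0)
    (h4 : ∀ a, s.mem 4 a = if a ∈ D.reds then 1 else 0) :
    scan.Halts W s (32 * D.N + 2) fun s =>
      D.Ctx s ∧ D.ScanMem D.N (s.mem 2) (s.mem 3) (s.mem 4) := by
  have h0 : (const 9 0).wp W (fun s => D.Ctx s ∧ s.reg 9 ≤ D.N ∧
      D.ScanMem (s.reg 9) (s.mem 2) (s.mem 3) (s.mem 4)) s := by
    simp only [wp, State.reg_setReg, State.mem_setReg, if_true]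
    refine ⟨by omega, hs.setReg (by norm_num) _, by omega, fun a => ?_, fun a => ?_, fun a => ?_⟩
    · rw [h4]; split_ifs <;> omega
    · rw [h4]; simp [forced_zero]
    · rw [h2, h3]
      exact ⟨fun b => by simp [edge_zero], fun _ => rfl, fun h => absurd rfl h⟩
  refine ((halts_of_wp h0).seq (fun s h => (halts_whileLt (fun s => D.Ctx s ∧ s.reg 9 ≤ D.N ∧
      D.ScanMem (s.reg 9) (s.mem 2) (s.mem 3) (s.mem 4)) (fun s => D.N - s.reg 9) ?_ s h).mono
    (T' := 32 * D.N + 1) ?_ ?_)).mono ?_ fun s h => h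
  · rintro s ⟨hs, h9, hm⟩ hlt
    rw [hs.r1] at hlt
    exact wp_scanBody hs hlt hm
  · simp only [scanBody, insertSlot, cost]
    omega
  · rintro s ⟨⟨hs, h9, hm⟩, hlt⟩
    rw [hs.r1] at hlt
    rw [le_antisymm h9 hlt] at hm
    exact ⟨hs, hm⟩
  · simp only [cost]
    omega

/-- The vertex `c` has the single neighbour `u` in `R`. -/
def Leaf (D : NetData W) (R : Finset ℕ) (c u : ℕ) : Prop :=
  u ∈ R ∧ D.Edge D.N c u ∧ ∀ w ∈ R, D.Edge D.N c w → w = u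

/-- The red vertices `R` arise from the initial ones by the rules. -/
structure Reduced (D : NetData W) (R : Finset ℕ) : Prop where
  subset : R ⊆ D.reds
  not_forced : ∀ a ∈ R, ¬ D.Forced D.N a
  optimal : ∀ I ⊆ D.reds, D.Admissible I →
    ∃ J ⊆ R, (∀ a ∈ J, ∀ b ∈ J, ¬ D.Edge D.N a b) ∧ I.card ≤ J.card

/-- Optimality survives the leaf rule because the witness `J` can be exchanged for one avoiding `u`.
-/
theorem Reduced.erase {R : Finset ℕ} (h : D.Reduced R) {c u : ℕ} (hc : c ∈ R)
    (hu : D.Leaf R c u) : D.Reduced (R.erase u) := by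
  refine ⟨(Finset.erase_subset _ _).trans h.subset,
    fun a ha => h.not_forced a (Finset.mem_of_mem_erase ha), fun I hI hI' => ?_⟩
  obtain ⟨J, hJ, hJ', hle⟩ := h.optimal I hI hI'
  obtain ⟨J', h1, h2, h3⟩ := exists_independent_erase (fun a b h => Edge.symm h)
    (fun a => Edge.irrefl) hc hu.2.1 hu.2.2 hJ hJ'
  exact ⟨J', h1, h2, hle.trans h3⟩

theorem exists_leaf_of_edge {R : Finset ℕ} {a b : ℕ} (ha : a ∈ R) (hb : b ∈ R)
    (hab : D.Edge D.N a b) : ∃ c ∈ R, ∃ u, D.Leaf R c u := by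
  obtain ⟨c, hc, u, hu, h1, h2⟩ := exists_leaf (E := D.Edge D.N) (fun a b h => Edge.symm h) D.row
    (fun a b h => h.row_ne) (fun a b c h h' hb hc => h.unique h' (by simp [hb, hc])) ha hb hab
  exact ⟨c, hc, u, hu, h1, h2⟩

/-- The invariant of the leaf rule, with the scanned vertex `v` and the current vertex `c`. -/
structure LeafMem (D : NetData W) (R : Finset ℕ) (v c : ℕ) (m₂ m₃ m₄ : ℕ → ℕ) : Prop where
  slots : ∀ a, IsSlots (m₂ a) (m₃ a) (D.Edge D.N a)
  color : ∀ a, m₄ a = if a ∈ R then 1 else 0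
  reduced : D.Reduced R
  le : v ≤ D.N + 1
  eq_or_le : c = v ∨ v ≤ D.N
  eq_of_leaf : ∀ x ∈ R, x ≤ v → ∀ u, D.Leaf R x u → x = c

/-- `c` loses its only red neighbour and is no leaf any more. Removing `u` affects only neighbours
of `u`, hence besides `c` only the other slot of `u`, which is the sum of both slots minus `c` (`0`
if there is none). -/
theorem LeafMem.fire {R : Finset ℕ} {v c u : ℕ} {m₂ m₃ m₄ : ℕ → ℕ} (h : D.LeafMem R v c m₂ m₃ m₄)
    (hv : v ≤ D.N) (hc : c ∈ R) (hu : D.Leaf R c u) :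
    D.LeafMem (R.erase u) v (m₂ u + m₃ u - c) m₂ m₃ (Function.update m₄ u 0) := by
  refine ⟨h.slots, fun a => ?_, h.reduced.erase hc hu, h.le, .inr hv, ?_⟩
  · rw [Function.update_apply, h.color]
    simp only [Finset.mem_erase]
    grind
  · rintro x hx hxv y ⟨hy, hxy, hy'⟩
    have hxR := Finset.mem_of_mem_erase hx
    have hxc : x ≠ c := by
      rintro rfl
      exact (Finset.mem_erase.1 hy).1 (hu.2.2 y (Finset.mem_of_mem_erase hy) hxy)
    -- If `x` is adjacent to `u`, then `x ≠ c` are its two slots. Otherwise `x` was a leaf before,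
    -- contradicting the invariant.
    by_cases hxu : D.Edge D.N x u
    · obtain ⟨-, h1⟩ := ((h.slots u).mem_iff x).1 hxu.symm
      obtain ⟨-, h2⟩ := ((h.slots u).mem_iff c).1 hu.2.1.symm
      omega
    · refine absurd (h.eq_of_leaf x hxR hxv y ⟨Finset.mem_of_mem_erase hy, hxy, fun w hw hxw => ?_⟩)
        hxc
      exact hy' w (Finset.mem_erase.2 ⟨by rintro rfl; exact hxu hxw, hw⟩) hxw

theorem LeafMem.advance {R : Finset ℕ} {v c : ℕ} {m₂ m₃ m₄ : ℕ → ℕ}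
    (h : D.LeafMem R v c m₂ m₃ m₄) (hv : v ≤ D.N) (hc : c ∈ R → ∀ u, ¬ D.Leaf R c u) :
    D.LeafMem R (v + 1) (v + 1) m₂ m₃ m₄ := by
  refine ⟨h.slots, h.color, h.reduced, by omega, .inl rfl, fun x hx hxv u hu => ?_⟩
  rcases Nat.le_succ_iff.1 hxv with hxv | hxv
  · obtain rfl := h.eq_of_leaf x hx hxv u hu
    exact absurd hu (hc hx u)
  · exact hxv

/-- An edge would produce a leaf, which the invariant identifies with `c`; but at the end `c = N +
1` is not a vertex. -/
theorem LeafMem.independent {R : Finset ℕ} {c : ℕ} {m₂ m₃ m₄ : ℕ → ℕ}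
    (h : D.LeafMem R (D.N + 1) c m₂ m₃ m₄) {a b : ℕ} (ha : a ∈ R) (hb : b ∈ R) :
    ¬ D.Edge D.N a b := by
  intro hab
  obtain ⟨x, hx, u, hu⟩ := exists_leaf_of_edge ha hb hab
  have h1 := (D.mem_reds x (h.reduced.subset hx)).2
  have h2 := h.eq_of_leaf x hx (by omega) u hu
  have h3 := h.eq_or_le
  omega

/-- Expresses the number of red vertices through the memory alone, as the loop variant must be a
function of the state. -/
theorem LeafMem.card_eq {R : Finset ℕ} {v c : ℕ} {m₂ m₃ m₄ : ℕ → ℕ}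
    (h : D.LeafMem R v c m₂ m₃ m₄) :
    ((Finset.range (D.N + 1)).filter fun a => m₄ a = 1).card = R.card := by
  congr 1
  ext a
  have := fun ha => D.mem_reds a (h.reduced.subset ha)
  simp only [Finset.mem_filter, Finset.mem_range, h.color]
  grind

theorem wp_leafBody {s : State} {R : Finset ℕ} (hs : D.Ctx s) (h20 : s.reg 20 = D.N + 1)
    (h9 : s.reg 9 < D.N + 1)
    (hm : D.LeafMem R (s.reg 9) (s.reg 10) (s.mem 2) (s.mem 3) (s.mem 4)) :
    leafBody.wp W (fun s' => D.Ctx s' ∧ s'.reg 20 = D.N + 1 ∧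
      ∃ R', D.LeafMem R' (s'.reg 9) (s'.reg 10) (s'.mem 2) (s'.mem 3) (s'.mem 4) ∧
        D.N + 1 - s'.reg 9 + R'.card < D.N + 1 - s.reg 9 + R.card) s := by
  have hW := D.le_word
  have hfire : ∀ u, s.reg 10 ∈ R → D.Leaf R (s.reg 10) u → s.mem 2 u + s.mem 3 u ≤ W ∧
      ∃ R', D.LeafMem R' (s.reg 9) (s.mem 2 u + s.mem 3 u - s.reg 10) (s.mem 2) (s.mem 3)
        (Function.update (s.mem 4) u 0) ∧
        R'.card < R.card := by
    intro u hc hu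
    -- Slot entries are at most `N`, so their sum fits into a word.
    have key : ∀ a, a = s.mem 2 u ∨ a = s.mem 3 u → a ≤ D.N := fun a ha => by
      by_cases h0 : a = 0
      · omega
      · exact (Edge.symm (((hm.slots u).mem_iff a).2 ⟨h0, ha⟩)).mem.2
    have k1 := key _ (.inl rfl)
    have k2 := key _ (.inr rfl)
    exact ⟨by omega, _, hm.fire (by omega) hc hu, Finset.card_erase_lt_of_mem hu.1⟩
  have hadv : (s.reg 10 ∈ R → ∀ u, ¬ D.Leaf R (s.reg 10) u) → s.reg 9 + 1 ≤ W ∧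
      ∃ R', D.LeafMem R' (s.reg 9 + 1) (s.reg 9 + 1) (s.mem 2) (s.mem 3) (s.mem 4) ∧
        D.N + 1 - (s.reg 9 + 1) + R'.card < D.N + 1 - s.reg 9 + R.card := fun hc =>
    ⟨by omega, R, hm.advance (by omega) hc, by omega⟩
  have hcol := hm.color
  have hsl := hm.slots (s.reg 10)
  have h0R : 0 ∉ R := fun h => by
    have := D.mem_reds 0 (hm.reduced.subset h)
    omega
  generalize hc : s.reg 10 = c at *
  generalize hp : s.mem 2 c = p at *
  generalize hq : s.mem 3 c = q at *
  have hpos : ∀ a, 0 < s.mem 4 a ↔ a ∈ R := fun a => by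
    rw [hcol]
    split_ifs <;> simp_all
  have hle : ∀ a, s.mem 4 a ≤ 1 := fun a => by
    rw [hcol]
    split_ifs <;> simp
  -- Comparing two colour cells therefore tests that exactly the second vertex is red.
  have hlt : ∀ a b, s.mem 4 a < s.mem 4 b ↔ a ∉ R ∧ b ∈ R := fun a b => by
    rw [← hpos, ← hpos]
    have := hle b
    omega
  simp only [leafBody, wp, State.reg_setReg, State.mem_setReg, State.mem_setMem,
      State.reg_setMem, hs.r3, hs.r0, h20, hc, reduceIte]
  norm_num [hp, hq]
  refine ⟨fun hcR => ⟨fun h => ⟨fun hp0 => ?_, fun hp0 => ?_⟩, fun h => ⟨fun h' => ⟨fun hq0 => ?_,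
    fun hq0 => ?_⟩, fun h' => ?_⟩⟩, fun hcR => ?_⟩
  · rw [hlt] at h
    obtain ⟨h1, h2⟩ := hfire p ((hpos c).1 hcR) ⟨h.2, (hsl.mem_iff p).2 ⟨hp0.ne', .inl rfl⟩, by
      intro w hw hcw
      rcases ((hsl.mem_iff w).1 hcw).2 with rfl | rfl
      · rfl
      · exact absurd hw h.1⟩
    refine ⟨h1, ?_, h2⟩
    repeat (first | exact hs | refine Ctx.setReg ?_ (by norm_num) _ |
      refine Ctx.setMem ?_ (by norm_num) _ _)
  -- The slot found red cannot be empty, since `0` is not red.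
  · rw [hlt] at h
    exact absurd (hp0 ▸ h.2) h0R
  · rw [hlt] at h'
    obtain ⟨h1, h2⟩ := hfire q ((hpos c).1 hcR) ⟨h'.2, (hsl.mem_iff q).2 ⟨hq0.ne', .inr rfl⟩, by
      intro w hw hcw
      rcases ((hsl.mem_iff w).1 hcw).2 with rfl | rfl
      · exact absurd hw h'.1
      · rfl⟩
    refine ⟨h1, ?_, h2⟩
    repeat (first | exact hs | refine Ctx.setReg ?_ (by norm_num) _ |
      refine Ctx.setMem ?_ (by norm_num) _ _)
  · rw [hlt] at h'
    exact absurd (hq0 ▸ h'.2) h0R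
  -- The slots have equal colours. If one is red, both are, and being distinct they keep `c` from
  -- being a leaf.
  · obtain ⟨h1, h2⟩ := hadv fun _ u hu => by
      rw [← not_lt, hlt] at h h'
      have hu' := (hsl.mem_iff u).1 hu.2.1
      have hpR : p ∈ R := by
        rcases hu'.2 with rfl | rfl
        · exact hu.1
        · by_contra hpR
          exact h' ⟨hpR, hu.1⟩
      have hqR : q ∈ R := by
        by_contra hqR
        exact h ⟨hqR, hpR⟩
      have hp0 : p ≠ 0 := by rintro rfl; exact h0R hpR
      have hq0 : q ≠ 0 := by rintro rfl; exact h0R hqR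
      have e1 := hu.2.2 p hpR ((hsl.mem_iff p).2 ⟨hp0, .inl rfl⟩)
      have e2 := hu.2.2 q hqR ((hsl.mem_iff q).2 ⟨hq0, .inr rfl⟩)
      exact hsl.ne_of_ne_zero hp0 (e1.trans e2.symm)
    refine ⟨h1, ?_, h2⟩
    repeat (first | exact hs | refine Ctx.setReg ?_ (by norm_num) _)
  · obtain ⟨h1, h2⟩ := hadv fun h => absurd ((hpos c).2 h) (by omega)
    refine ⟨h1, ?_, h2⟩
    repeat (first | exact hs | refine Ctx.setReg ?_ (by norm_num) _)

/-- The rule starts from the unforced red vertices, which contain every admissible set of red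
vertices. Numbering begins at `1`, so the only vertex scanned so far is the current one. -/
theorem ScanMem.exists_leafMem {m₂ m₃ m₄ : ℕ → ℕ} (h : D.ScanMem D.N m₂ m₃ m₄) :
    ∃ R, D.LeafMem R 1 1 m₂ m₃ m₄ := by
  classical
  refine ⟨D.reds.filter fun a => ¬ D.Forced D.N a, h.slots, fun a => ?_, ⟨Finset.filter_subset _ _,
    fun a ha => (Finset.mem_filter.1 ha).2, fun I hI hI' => ⟨I, fun a ha => Finset.mem_filter.2
      ⟨hI ha, hI'.1 a ha⟩, hI'.2, le_rfl⟩⟩, by omega, .inl rfl, fun x hx hx1 u hu => ?_⟩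
  · have h1 := h.le_one a
    have h2 := h.color a
    simp only [Finset.mem_filter]
    split_ifs with h3
    · exact h2.2 h3
    · have := mt h2.1 h3
      omega
  · have := D.mem_reds x (Finset.mem_filter.1 hx).1
    omega

theorem halts_leafRule {s : State} (hs : D.Ctx s)
    (hm : D.ScanMem D.N (s.mem 2) (s.mem 3) (s.mem 4)) :
    leafRule.Halts W s (46 * D.N + 50) fun s => D.Ctx s ∧ ∃ R, D.Reduced R ∧
      (∀ a ∈ R, ∀ b ∈ R, ¬ D.Edge D.N a b) ∧ ∀ a, s.mem 4 a = if a ∈ R then 1 else 0 := by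
  let I : State → Prop := fun s => D.Ctx s ∧ s.reg 20 = D.N + 1 ∧
    ∃ R, D.LeafMem R (s.reg 9) (s.reg 10) (s.mem 2) (s.mem 3) (s.mem 4)
  -- Each round either paints a red vertex or advances the sweep, hence at most `2N + 2` rounds,
  -- despite the jumps back and forth.
  let φ : State → ℕ := fun s => D.N + 1 - s.reg 9 +
    ((Finset.range (D.N + 1)).filter fun a => s.mem 4 a = 1).card
  have hφ : ∀ s, φ s ≤ 2 * D.N + 2 := fun s => by
    have := Finset.card_filter_le (Finset.range (D.N + 1)) fun a => s.mem 4 a = 1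
    rw [Finset.card_range] at this
    simp only [φ]
    omega
  have hW := D.le_word
  have hloop : ∀ s, I s → (whileLt 9 20 leafBody).Halts W s (46 * D.N + 47) fun s => D.Ctx s ∧
      ∃ R, D.Reduced R ∧ (∀ a ∈ R, ∀ b ∈ R, ¬ D.Edge D.N a b) ∧
        ∀ a, s.mem 4 a = if a ∈ R then 1 else 0 := by
    intro s hs
    refine (halts_whileLt I φ ?_ s hs).mono ?_ ?_
    · rintro s ⟨hs, h20, R, hR⟩ hlt
      refine wp_mono ?_ (wp_leafBody hs h20 (h20 ▸ hlt) hR)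
      rintro s' ⟨hs', h20', R', hR', hlt'⟩
      refine ⟨⟨hs', h20', R', hR'⟩, ?_⟩
      simp only [φ, hR.card_eq, hR'.card_eq]
      exact hlt'
    · have := hφ s
      simp only [leafBody, cost]
      omega
    · rintro s ⟨⟨hs, h20, R, hR⟩, hlt⟩
      rw [h20] at hlt
      have h9 := le_antisymm hR.le hlt
      rw [h9] at hR
      exact ⟨hs, R, hR.reduced, fun a ha b hb => hR.independent ha hb, hR.color⟩
  have hinit : (((copy 9 3).seq <| (copy 10 3).seq <| add 20 1 3)).wp W I s := by
    obtain ⟨R, hR⟩ := hm.exists_leafMem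
    simp only [wp, State.reg_setReg, I, State.mem_setReg]
    norm_num [hs.r1, hs.r3]
    refine ⟨by omega, ?_, R, hR⟩
    repeat (first | exact hs | refine Ctx.setReg ?_ (by norm_num) _)
  obtain ⟨s₁, t₁, e₁, l₁, h₁⟩ := halts_of_wp hinit
  obtain ⟨s₂, t₂, e₂, l₂, h₂⟩ := hloop s₁ h₁
  -- The run of the three assignments is taken apart and reassociated to match the nesting of
  -- `leafRule`.
  cases e₁ with
  | seq e e' => cases e' with
    | seq e' e'' =>
      refine ⟨s₂, _, .seq e (.seq e' (.seq e'' e₂)), ?_, h₂⟩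
      simp only [cost] at l₁
      omega

/-- The colour changes among the first `i` vertices. -/
theorem card_sdiff_filter_succ {X : Finset ℕ} (i : ℕ) :
    (X.filter fun a => a ≤ i + 1).card =
      (X.filter fun a => a ≤ i).card + if i + 1 ∈ X then 1 else 0 := by
  split_ifs with h
  · rw [← Finset.card_insert_of_notMem (s := X.filter fun a => a ≤ i) (a := i + 1) (by simp)]
    congr 1
    ext a
    simp only [Finset.mem_filter, Finset.mem_insert]
    grind
  · rw [add_zero]
    congr 1
    ext a
    simp only [Finset.mem_filter]
    grind

theorem halts_output {s : State} {R : Finset ℕ} (hs : D.Ctx s) (hR : R ⊆ D.reds)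
    (h4 : ∀ a, s.mem 4 a = if a ∈ R then 1 else 0) :
    output.Halts W s (9 * D.N + 6) fun s =>
      (s.reg 0 = if (D.reds \ R).card ≤ D.k then 1 else 0) ∧
      ∀ v < D.N, s.mem 1 v = if v + 1 ∈ R then 1 else 0 := by
  let I : State → Prop := fun s => D.Ctx s ∧ s.reg 9 ≤ D.N ∧
    (∀ a, s.mem 4 a = if a ∈ R then 1 else 0) ∧
    (∀ v < s.reg 9, s.mem 1 v = if v + 1 ∈ R then 1 else 0) ∧
    s.reg 16 = ((D.reds \ R).filter fun a => a ≤ s.reg 9).card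
  have hW := D.le_word
  have hW4 := D.four_le
  have h9 : (const 9 0).wp W (fun s => (const 16 0).wp W I s) s := by
    simp only [wp, State.reg_setReg, State.mem_setReg, I]
    norm_num
    refine ⟨?_, h4, ?_⟩
    · repeat (first | exact hs | refine Ctx.setReg ?_ (by norm_num) _)
    · symm
      rw [Finset.card_eq_zero, Finset.filter_eq_empty_iff]
      intro a ha
      have := D.mem_reds a (Finset.mem_sdiff.1 ha).1
      omega
  have hbody : ∀ s, I s → s.reg 9 < s.reg 1 →
      outputBody.wp W (fun s' => I s' ∧ D.N - s'.reg 9 < D.N - s.reg 9) s := by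
    rintro s ⟨hs, h9, h4, h1, h16⟩ hlt
    rw [hs.r1] at hlt
    have hc := D.inp_color _ hlt
    have hcard := card_sdiff_filter_succ (X := D.reds \ R) (s.reg 9)
    -- Keeps the change counter within the word size.
    have hle : ((D.reds \ R).filter fun a => a ≤ s.reg 9).card ≤ s.reg 9 := by
      have : ((D.reds \ R).filter fun a => a ≤ s.reg 9) ⊆ Finset.Icc 1 (s.reg 9) := by
        intro a ha
        rw [Finset.mem_filter, Finset.mem_sdiff] at ha
        exact Finset.mem_Icc.2 ⟨(D.mem_reds a ha.1.1).1, ha.2⟩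
      simpa using Finset.card_le_card this
    -- As `R ⊆ reds`, the truncated difference of old and new colour is `1` exactly at a change.
    have hd : (if s.reg 9 + 1 ∈ D.reds then 1 else 0) - (if s.reg 9 + 1 ∈ R then 1 else 0) =
        if s.reg 9 + 1 ∈ D.reds \ R then 1 else 0 := by
      simp only [Finset.mem_sdiff]
      have := @hR (s.reg 9 + 1)
      split_ifs <;> grind
    have hd1 : (if s.reg 9 + 1 ∈ D.reds \ R then 1 else 0) ≤ 1 := by split_ifs <;> omega
    generalize (if s.reg 9 + 1 ∈ D.reds \ R then 1 else 0) = δ at hcard hd hd1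
    simp only [outputBody, wp, State.reg_setReg, State.mem_setReg, State.mem_setMem,
      State.reg_setMem, hs.r4, hs.r3, hs.m0, I, reduceIte]
    norm_num [hc, h4, h16, hd, hcard]
    refine ⟨by omega, by omega, by omega, by omega, ⟨?_, by omega, fun v hv => ?_⟩, by omega⟩
    · repeat (first | exact hs | refine Ctx.setReg ?_ (by norm_num) _ |
        refine Ctx.setMem ?_ (by norm_num) _ _)
    · rw [Function.update_apply]
      by_cases e : v = s.reg 9
      · rw [if_pos e, e]
      · rw [if_neg e, h1 v (by omega)]
  have hend : ∀ s, I s ∧ s.reg 1 ≤ s.reg 9 → (ifLt 2 16 (const 0 0) (const 0 1)).wp W (fun s =>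
      (s.reg 0 = if (D.reds \ R).card ≤ D.k then 1 else 0) ∧
      ∀ v < D.N, s.mem 1 v = if v + 1 ∈ R then 1 else 0) s := by
    rintro s ⟨⟨hs, h9, h4, h1, h16⟩, hle⟩
    rw [hs.r1] at hle
    rw [le_antisymm h9 hle] at h16 h1
    rw [Finset.filter_true_of_mem fun a ha => (D.mem_reds a (Finset.mem_sdiff.1 ha).1).2] at h16
    simp only [wp, State.reg_setReg, State.mem_setReg, hs.r2, h16, reduceIte]
    refine ⟨fun h => ⟨by omega, (if_neg (by omega)).symm, h1⟩,
      fun h => ⟨by omega, (if_pos (by omega)).symm, h1⟩⟩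
  refine ((halts_of_wp h9).seq fun s hs => (halts_of_wp hs).seq fun s hs =>
    ((halts_whileLt I (fun s => D.N - s.reg 9) hbody s hs).mono (T' := 9 * D.N + 1) ?_
      fun s h => h).seq fun s hs => halts_of_wp (hend s hs)).mono ?_ fun s h => h
  · simp only [outputBody, cost]
    omega
  · simp only [cost]
    omega

theorem halts_main {s : State} (hs : D.Ctx s) (h9 : s.reg 9 = 0)
    (hm : ∀ B, B ≠ 0 → ∀ i, s.mem B i = 0) :
    main.Halts W s (92 * D.N + 60) fun s => ∃ R, D.Reduced R ∧ D.Admissible R ∧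
      (s.reg 0 = if (D.reds \ R).card ≤ D.k then 1 else 0) ∧
      ∀ v < D.N, s.mem 1 v = if v + 1 ∈ R then 1 else 0 := by
  refine ((halts_copyColors hs h9 hm).seq fun s h => (halts_scan h.1 h.2.1 h.2.2.1 h.2.2.2).seq
    fun s h => (halts_leafRule h.1 h.2).seq fun s ⟨h, R, hR, hind, h4⟩ =>
      (halts_output h hR.subset h4).mono le_rfl fun s h =>
        ⟨R, hR, ⟨hR.not_forced, hind⟩, h⟩).mono (by omega) fun s h => h

end NetData

/-! ### Counting colours in adjacency lists -/

theorem Color.ne_red {c : Color} : c ≠ Color.red ↔ c = Color.blue := by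
  cases c <;> simp

theorem Color.ne_blue {c : Color} : c ≠ Color.blue ↔ c = Color.red := by
  cases c <;> simp

section Lists

variable {N : ℕ} {G : Digraph (Fin N)} {adj : Fin N → List (Fin N)}

open Classical in
theorem ncard_outNbrs_inter (h : IsAdjList G adj) (x : Fin N) (P : Fin N → Prop) :
    (outNbrs G x ∩ {u | P u}).ncard = (adj x).countP P := by
  have : outNbrs G x ∩ {u | P u} = ((adj x).filter P).toFinset := by
    ext u
    simp [outNbrs, (h x).2]
  rw [this, Set.ncard_coe_finset, List.toFinset_card_of_nodup ((h x).1.filter _),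
    List.countP_eq_length_filter]

theorem ncard_outNbrs (h : IsAdjList G adj) (x : Fin N) :
    (outNbrs G x).ncard = (adj x).length := by
  classical
  have := ncard_outNbrs_inter h x fun _ => True
  simpa using this

open Classical in
theorem blueCount_eq (h : IsAdjList G adj) (g : Fin N → Color) (x : Fin N) :
    blueCount G g x = (adj x).countP fun u => g u = Color.blue :=
  ncard_outNbrs_inter h x _

open Classical in
theorem redCount_eq (h : IsAdjList G adj) (g : Fin N → Color) (x : Fin N) :
    redCount G g x = (adj x).countP fun u => g u = Color.red :=
  ncard_outNbrs_inter h x _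

open Classical in
/-- Each vertex with one out-neighbour has at least `c₁` blue out-neighbours, and each vertex with
two of them at least `c₂`. -/
def Meets (adj : Fin N → List (Fin N)) (c₁ c₂ : ℕ) (g : Fin N → Color) : Prop :=
  ∀ x, ((adj x).length = 1 → c₁ ≤ (adj x).countP fun u => g u = Color.blue) ∧
    ((adj x).length = 2 → c₂ ≤ (adj x).countP fun u => g u = Color.blue)

theorem illusionFree_iff_meets (h : IsAdjList G adj) (hlen : ∀ x, (adj x).length ≤ 2)
    (g : Fin N → Color) : IllusionFree G g ↔ Meets adj 1 1 g := by
  classical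
  refine forall_congr' fun x => ?_
  rw [UnderIllusion, deficiency, redCount_eq h, blueCount_eq h]
  have hx := hlen x
  rcases hL : adj x with _ | ⟨a, _ | ⟨b, _ | ⟨c, l⟩⟩⟩
  · simp
  · cases ha : g a <;> simp [ha]
  · cases ha : g a <;> cases hb : g b <;> simp [ha, hb]
  · simp [hL] at hx

theorem pIllusionFree_iff_meets (h : IsAdjList G adj) (hlen : ∀ x, (adj x).length ≤ 2) (p : ℚ)
    (g : Fin N → Color) : PIllusionFree p G g ↔ Meets adj ⌈p⌉₊ ⌈p * 2⌉₊ g := by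
  classical
  refine forall_congr' fun x => ?_
  rw [UnderPIllusion, pDeficiency, blueCount_eq h, ncard_outNbrs h]
  have hx := hlen x
  rcases hL : adj x with _ | ⟨a, _ | ⟨b, _ | ⟨c, l⟩⟩⟩
  · simp
  · simp
  · norm_num [Nat.sub_eq_zero_iff_le]
  · simp [hL] at hx

end Lists

/-! ### Outward grids -/

section Grid

variable {m n N : ℕ} {G : Digraph (Fin N)}

/-- The coordinates of an outward grid. -/
theorem IsOutwardGrid.exists_coord (h : IsOutwardGrid m n G) : ∃ row col : Fin N → ℕ,
    (∀ u v, row u = row v → col u = col v → u = v) ∧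
    (∀ u v, G.Adj u v → row v = row u ∧ col v = col u + 1 ∨ row v = row u + 1 ∧ col v = col u) := by
  obtain ⟨e, he⟩ := h
  refine ⟨fun v => (e v).1, fun v => (e v).2, fun u v h1 h2 => ?_, fun u v huv => (he u v).1 huv⟩
  exact e.injective (Prod.ext (Fin.ext h1) (Fin.ext h2))

theorem IsOutwardGrid.card_eq (h : IsOutwardGrid m n G) : N = m * n := by
  obtain ⟨e, -⟩ := h
  simpa using Fintype.card_congr e

/-- The rows of an outward grid, and the pairs of out-neighbours of a vertex. -/
theorem IsOutwardGrid.exists_row (h : IsOutwardGrid m n G) : ∃ row : Fin N → ℕ,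
    (∀ x a b, G.Adj x a → G.Adj x b → a ≠ b → row b ≠ row a) ∧
    (∀ x a b c, G.Adj x a → G.Adj x b → G.Adj x c → a = b ∨ a = c ∨ b = c) ∧
    ∀ x y a b c, G.Adj x a → G.Adj x b → a ≠ b → G.Adj y a → G.Adj y c → a ≠ c →
      (row a < row b ↔ row a < row c) → b = c ∧ x = y := by
  obtain ⟨row, col, inj, hadj⟩ := h.exists_coord
  -- In equal rows both would be the right neighbour, or both the lower neighbour, of `x`.
  have key : ∀ x a b, G.Adj x a → G.Adj x b → a ≠ b → row b ≠ row a := fun x a b ha hb hab hr => by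
    have h1 := hadj _ _ ha
    have h2 := hadj _ _ hb
    exact hab (inj _ _ hr.symm (by omega))
  refine ⟨row, key, fun x a b c ha hb hc => ?_, fun x y a b c ha hb hab ha' hc hac hr => ?_⟩
  -- Three distinct out-neighbours would need three distinct rows, but only `row x` and `row x + 1`
  -- occur.
  · by_contra! hne
    have k1 := key _ _ _ ha hb hne.1
    have k2 := key _ _ _ ha hc hne.2.1
    have k3 := key _ _ _ hb hc hne.2.2
    have h1 := (hadj _ _ ha).imp And.left And.left
    have h2 := (hadj _ _ hb).imp And.left And.left
    have h3 := (hadj _ _ hc).imp And.left And.left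
    omega
  · have k1 := key _ _ _ ha hb hab
    have k2 := key _ _ _ ha' hc hac
    -- The side of `b` tells whether `a` is the right or the lower neighbour of `x`; this fixes `x`,
    -- and then `b`.
    rcases hadj _ _ ha with h1 | h1 <;> rcases hadj _ _ hb with h2 | h2 <;>
      rcases hadj _ _ ha' with h3 | h3 <;> rcases hadj _ _ hc with h4 | h4 <;>
      first
        | exact absurd (h2.1.trans h1.1.symm) k1
        | exact absurd (h4.1.trans h3.1.symm) k2
        | omega
        | exact ⟨inj _ _ (by omega) (by omega), inj _ _ (by omega) (by omega)⟩

theorem IsOutwardGrid.length_le (h : IsOutwardGrid m n G) {adj : Fin N → List (Fin N)}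
    (hadj : IsAdjList G adj) (x : Fin N) : (adj x).length ≤ 2 := by
  obtain ⟨row, -, h3, -⟩ := h.exists_row
  have hx := hadj x
  rcases hL : adj x with _ | ⟨a, _ | ⟨b, _ | ⟨c, l⟩⟩⟩
  · simp
  · simp
  · simp
  · rw [hL] at hx
    have := h3 x a b c ((hx.2 a).1 (by simp)) ((hx.2 b).1 (by simp)) ((hx.2 c).1 (by simp))
    have hnd := hx.1
    simp only [List.nodup_cons, List.mem_cons] at hnd
    tauto

end Grid

/-! ### Reading the input -/

theorem getElem?_flatten {α : Type*} (L : List (List α)) (i j : ℕ) (hi : i < L.length)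
    (hj : j < L[i].length) :
    L.flatten[((L.take i).map List.length).sum + j]? = some L[i][j] := by
  induction L generalizing i with
  | nil => simp at hi
  | cons l L ih =>
    cases i with
    | zero =>
      simp only [List.getElem_cons_zero] at hj
      simp [List.getElem?_append_left hj, hj]
    | succ i =>
      simp only [List.length_cons, Nat.add_lt_add_iff_right] at hi
      simp only [List.getElem_cons_succ] at hj ⊢
      rw [← ih i hi hj]
      simp only [List.flatten_cons, List.take_succ_cons, List.map_cons, List.sum_cons]
      rw [List.getElem?_append_right (by omega)]
      congr 1
      omega

section Encoding

variable {N : ℕ} (adj : Fin N → List (Fin N)) (f : Fin N → Color)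

/-- The total length of the first `x` adjacency lists. -/
def adjOffset (x : ℕ) : ℕ := (((List.ofFn adj).take x).map List.length).sum

theorem encodeNetwork_eq : encodeNetwork adj f = List.ofFn (fun v => (f v).code)
    ++ (List.range (N + 1)).map (adjOffset adj)
    ++ (List.ofFn adj).flatten.map Fin.val := by
  -- The coercion of the vertex list to natural numbers is a monadic bind; it is turned into a plain
  -- `map`.
  rw [encodeNetwork, List.bind_eq_flatMap]
  simp only [List.pure_def, List.map_id', ← List.map_eq_flatMap]
  rfl

theorem length_encodeNetwork :
    (encodeNetwork adj f).length = N + N + 1 + adjOffset adj N := by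
  have : (List.ofFn adj).take N = List.ofFn adj := List.take_of_length_le (by simp)
  rw [encodeNetwork_eq, adjOffset, this]
  simp only [List.length_append, List.length_ofFn, List.length_map, List.length_range,
    List.length_flatten]
  omega

theorem getD_encodeNetwork_color (v : Fin N) :
    (encodeNetwork adj f).getD v 0 = (f v).code := by
  have hv := v.2
  rw [encodeNetwork_eq, List.append_assoc, List.getD_append _ _ _ _ (by simp),
    List.getD_eq_getElem _ _ (by simp)]
  simp

theorem getD_encodeNetwork_offset {x : ℕ} (hx : x ≤ N) :
    (encodeNetwork adj f).getD (N + x) 0 = adjOffset adj x := by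
  rw [encodeNetwork_eq, List.append_assoc, List.getD_append_right _ _ _ _ (by simp),
    List.getD_append _ _ _ _ (by simp; omega), List.getD_eq_getElem _ _ (by simp; omega)]
  simp

theorem getD_encodeNetwork_adj (x : Fin N) {j : ℕ} (hj : j < (adj x).length) :
    (encodeNetwork adj f).getD (N + N + 1 + adjOffset adj x + j) 0 = (adj x)[j] := by
  have h := getElem?_flatten (List.ofFn adj) x j (by simp) (by simpa using hj)
  rw [encodeNetwork_eq, List.getD_append_right _ _ _ _ (by simp; omega), List.getD_eq_getElem?_getD]
  simp only [List.length_append, List.length_ofFn, List.length_map, List.length_range]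
  rw [show N + N + 1 + adjOffset adj x + j - (N + (N + 1)) = adjOffset adj x + j by omega,
    List.getElem?_map, adjOffset, h]
  simp

theorem adjOffset_succ (x : Fin N) :
    adjOffset adj (x + 1) = adjOffset adj x + (adj x).length := by
  rw [adjOffset, adjOffset, List.take_add_one]
  simp

end Encoding

/-! ### Translation between coloured networks and the data of the machine -/

section Network

variable {m n N : ℕ} {G : Digraph (Fin N)} {adj : Fin N → List (Fin N)}

/-- The set of the numbers, counted from `1`, of the vertices with a property. -/
noncomputable def vertexSet {N : ℕ} (P : Fin N → Prop) : Finset ℕ :=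
  open Classical in
  (Finset.univ.filter P).map
    ⟨fun v : Fin N => (v : ℕ) + 1, fun _ _ h => Fin.ext (Nat.succ_injective h)⟩

theorem mem_vertexSet {P : Fin N → Prop} {a : ℕ} :
    a ∈ vertexSet P ↔ ∃ v : Fin N, P v ∧ (v : ℕ) + 1 = a := by
  simp only [vertexSet, Finset.mem_map, Finset.mem_filter, Finset.mem_univ, true_and]
  rfl

theorem succ_mem_vertexSet {P : Fin N → Prop} {v : Fin N} : (v : ℕ) + 1 ∈ vertexSet P ↔ P v := by
  rw [mem_vertexSet]
  constructor
  · rintro ⟨u, hu, h⟩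
    rwa [← Fin.ext (Nat.succ_injective h)]
  · exact fun h => ⟨v, h, rfl⟩

theorem card_vertexSet (P : Fin N → Prop) : (vertexSet P).card = {v | P v}.ncard := by
  classical
  rw [vertexSet, Finset.card_map, Set.ncard_eq_toFinset_card']
  congr 1
  ext
  simp

/-- The adjacency lists, with the vertices counted from `1`. -/
def shiftedNbrs (adj : Fin N → List (Fin N)) (x : ℕ) : List ℕ :=
  if h : x < N then (adj ⟨x, h⟩).map fun u : Fin N => (u : ℕ) + 1 else []

theorem shiftedNbrs_val (x : Fin N) :
    shiftedNbrs adj x = (adj x).map fun u : Fin N => (u : ℕ) + 1 := by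
  simp [shiftedNbrs]

theorem shiftedNbrs_of_le {x : ℕ} (hx : N ≤ x) : shiftedNbrs adj x = [] := by
  simp [shiftedNbrs, hx]

theorem exists_of_mem_shiftedNbrs {x a : ℕ} (h : a ∈ shiftedNbrs adj x) :
    ∃ y u : Fin N, (y : ℕ) = x ∧ (u : ℕ) + 1 = a ∧ u ∈ adj y := by
  rcases lt_or_ge x N with hx | hx
  · rw [shiftedNbrs, dif_pos hx, List.mem_map] at h
    obtain ⟨u, hu, rfl⟩ := h
    exact ⟨⟨x, hx⟩, u, rfl, rfl, hu⟩
  · simp [shiftedNbrs_of_le hx] at h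

theorem adj_of_shiftedNbrs_eq (hadj : IsAdjList G adj) {x a b : ℕ}
    (h : shiftedNbrs adj x = [a, b] ∨ shiftedNbrs adj x = [b, a]) :
    ∃ y u v : Fin N, (y : ℕ) = x ∧ (u : ℕ) + 1 = a ∧ (v : ℕ) + 1 = b ∧
      G.Adj y u ∧ G.Adj y v ∧ u ≠ v := by
  have ha : a ∈ shiftedNbrs adj x := by rcases h with h | h <;> simp [h]
  have hb : b ∈ shiftedNbrs adj x := by rcases h with h | h <;> simp [h]
  obtain ⟨y, u, rfl, rfl, hu⟩ := exists_of_mem_shiftedNbrs ha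
  obtain ⟨y', v, hy, rfl, hv⟩ := exists_of_mem_shiftedNbrs hb
  obtain rfl := Fin.ext hy
  refine ⟨y', u, v, rfl, rfl, rfl, ((hadj y').2 u).1 hu, ((hadj y').2 v).1 hv, ?_⟩
  rintro rfl
  have hnd := (hadj y').1.map (f := fun u : Fin N => (u : ℕ) + 1)
    (fun u v h => Fin.ext (Nat.succ_injective h))
  rw [← shiftedNbrs_val] at hnd
  rcases h with h | h <;> simp [h] at hnd

/-- The machine's view of a coloured outward grid. -/
theorem IsOutwardGrid.exists_netData {W : ℕ} (h : IsOutwardGrid m n G) (hadj : IsAdjList G adj)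
    (f : Fin N → Color) (header : List ℕ) (k c₁ c₂ : ℕ)
    (hW : (header ++ encodeNetwork adj f).length ≤ W) (hW4 : 4 ≤ W) :
    ∃ D : NetData W, D.N = N ∧ D.k = k ∧ D.base = header.length ∧ D.need₁ = c₁ ∧ D.need₂ = c₂ ∧
      D.nbrs = shiftedNbrs adj ∧ D.reds = vertexSet (fun v => f v = Color.red) ∧
      D.inp = fun i => (header ++ encodeNetwork adj f).getD i 0 := by
  classical
  obtain ⟨row, h1, h2, h3⟩ := h.exists_row
  have hlen := h.length_le hadj
  have happ : ∀ i, (header ++ encodeNetwork adj f).getD (header.length + i) 0 =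
      (encodeNetwork adj f).getD i 0 := fun i => by
    rw [List.getD_append_right _ _ _ _ (by omega), Nat.add_sub_cancel_left]
  -- The machine counts vertices from `1`; the value outside `1, …, N` does not matter, because no
  -- list contains such a number.
  let row' : ℕ → ℕ := fun a => if h : a - 1 < N then row ⟨a - 1, h⟩ else 0
  have hrow' : ∀ u : Fin N, row' (u + 1) = row u := fun u => by simp [row']
  refine ⟨{
    N := N
    k := k
    base := header.length
    need₁ := c₁
    need₂ := c₂
    nbrs := shiftedNbrs adj
    reds := vertexSet (fun v => f v = Color.red)
    inp := fun i => (header ++ encodeNetwork adj f).getD i 0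
    off := adjOffset adj
    row := row'
    length_le := fun x => ?_
    nodup := fun x => ?_
    mem_nbrs := fun x a ha => ?_
    mem_reds := fun a ha => ?_
    inp_color := fun v hv => ?_
    inp_off := fun x hx => ?_
    off_succ := fun x hx => ?_
    inp_nbrs := fun x hx j hj => ?_
    le_word := ?_
    four_le := hW4
    row_ne := fun x a b hab => ?_
    unique := fun x y a b c hab hac hr => ?_ }, rfl, rfl, rfl, rfl, rfl, rfl, rfl, rfl⟩
  · rw [shiftedNbrs]
    split_ifs with hx
    · simpa using hlen _
    · simp
  · rw [shiftedNbrs]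
    split_ifs with hx
    · exact (hadj _).1.map (fun u v h => Fin.ext (Nat.succ_injective h))
    · simp
  · obtain ⟨y, u, -, rfl, -⟩ := exists_of_mem_shiftedNbrs ha
    have := u.2
    omega
  · obtain ⟨v, -, rfl⟩ := mem_vertexSet.1 ha
    have := v.2
    omega
  · rw [happ, getD_encodeNetwork_color adj f ⟨v, hv⟩]
    have := succ_mem_vertexSet (P := fun v => f v = Color.red) (v := ⟨v, hv⟩)
    simp only at this
    simp only [this]
    cases f ⟨v, hv⟩ <;> simp [Color.code]
  · rw [add_assoc, happ, getD_encodeNetwork_offset adj f hx]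
  · rw [adjOffset_succ adj ⟨x, hx⟩, shiftedNbrs, dif_pos hx, List.length_map]
  · have hs := shiftedNbrs_val (adj := adj) ⟨x, hx⟩
    simp only at hs
    simp only [hs, List.length_map, List.getElem_map] at hj ⊢
    rw [← getD_encodeNetwork_adj adj f ⟨x, hx⟩ hj, ← happ]
    congr 2
    simp only
    omega
  · rw [List.length_append, length_encodeNetwork] at hW
    omega
  · obtain ⟨y, u, v, rfl, rfl, rfl, hu, hv, huv⟩ := adj_of_shiftedNbrs_eq hadj hab
    rw [hrow', hrow']
    exact h1 y u v hu hv huv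
  · obtain ⟨z, u, v, rfl, rfl, rfl, hu, hv, huv⟩ := adj_of_shiftedNbrs_eq hadj hab
    obtain ⟨z', u', w, rfl, hu', rfl, hu'', hw, huw⟩ := adj_of_shiftedNbrs_eq hadj hac
    obtain rfl : u' = u := Fin.ext (Nat.succ_injective hu')
    rw [hrow', hrow', hrow'] at hr
    obtain ⟨rfl, rfl⟩ := h3 z z' u' v w hu hv huv hu'' hw huw hr
    exact ⟨rfl, rfl⟩

namespace NetData

variable {W : ℕ} {D : NetData W}

/-- The requirements only bound red from above, so any set of `g`-red vertices inherits them. -/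
theorem Admissible.of_meets (hN : D.N = N) (hnbrs : D.nbrs = shiftedNbrs adj)
    {g : Fin N → Color} (hg : Meets adj D.need₁ D.need₂ g) {I : Finset ℕ}
    (hI : ∀ v : Fin N, (v : ℕ) + 1 ∈ I → g v = Color.red) : D.Admissible I := by
  classical
  have key : ∀ x : Fin N, ∀ a ∈ I, a ∈ shiftedNbrs adj x → ∃ u ∈ adj x, (u : ℕ) + 1 = a ∧
      g u = Color.red := by
    intro x a ha h
    rw [shiftedNbrs_val, List.mem_map] at h
    obtain ⟨u, hu, rfl⟩ := h
    exact ⟨u, hu, rfl, hI u ha⟩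
  constructor
  · rintro a ha ⟨x, hx, hax, h⟩
    rw [hN] at hx
    rw [hnbrs] at hax h
    obtain ⟨u, hu, rfl, hgu⟩ := key ⟨x, hx⟩ a ha hax
    have hs := shiftedNbrs_val (adj := adj) ⟨x, hx⟩
    simp only at hs
    rw [hs, List.length_map] at h
    obtain ⟨g1, g2⟩ := hg ⟨x, hx⟩
    have hlt : ((adj ⟨x, hx⟩).countP fun u => g u = Color.blue) < (adj ⟨x, hx⟩).length := by
      refine lt_of_le_of_ne List.countP_le_length fun h => ?_
      rw [List.countP_eq_length] at h
      simpa [hgu] using h u hu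
    omega
  · rintro a ha b hb ⟨h1, x, hx, h⟩
    rw [hN] at hx
    rw [hnbrs] at h
    have hs := shiftedNbrs_val (adj := adj) ⟨x, hx⟩
    simp only at hs
    have hlen : (adj ⟨x, hx⟩).length = 2 := by
      have := congrArg List.length hs
      rw [List.length_map] at this
      rw [← this]
      rcases h with h | h <;> simp [h]
    have h0 : ((adj ⟨x, hx⟩).countP fun u => g u = Color.blue) = 0 := by
      rw [List.countP_eq_zero]
      intro u hu
      have hu' : (u : ℕ) + 1 ∈ shiftedNbrs adj x := by
        rw [hs]
        exact List.mem_map.2 ⟨u, hu, rfl⟩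
      have : g u = Color.red := hI u (by rcases h with h | h <;> simp [h] at hu' <;> grind)
      simp [this]
    have := (hg ⟨x, hx⟩).2 hlen
    omega

/-- With `need₁ ≤ 1` and `need₂ ≤ 2`, forced vertices and edges express all possible requirements.
-/
theorem Admissible.meets (hN : D.N = N) (hnbrs : D.nbrs = shiftedNbrs adj) (h1 : D.need₁ ≤ 1)
    (h2 : D.need₂ ≤ 2) {R : Finset ℕ} (hR : D.Admissible R) {g : Fin N → Color}
    (hg : ∀ v : Fin N, g v = Color.red → (v : ℕ) + 1 ∈ R) : Meets adj D.need₁ D.need₂ g := by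
  classical
  intro x
  have hs := hnbrs ▸ shiftedNbrs_val (adj := adj) x
  have hx : (x : ℕ) < D.N := hN ▸ x.2
  have hF : ∀ u ∈ adj x, g u = Color.red → ¬ ((D.nbrs x).length = 1 ∧ 0 < D.need₁ ∨
      (D.nbrs x).length = 2 ∧ 1 < D.need₂) := fun u hu hgu h =>
    hR.1 _ (hg u hgu) ⟨x, hx, by rw [hs]; exact List.mem_map.2 ⟨u, hu, rfl⟩, h⟩
  have hE : ∀ u v, g u = Color.red → g v = Color.red → D.need₂ = 1 → adj x ≠ [u, v] :=
    fun u v hu hv hn h => hR.2 _ (hg u hu) _ (hg v hv) ⟨hn, x, hx, .inl (by rw [hs, h]; simp)⟩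
  rw [hs, List.length_map] at hF
  rcases hL : adj x with _ | ⟨a, _ | ⟨b, _ | ⟨c, l⟩⟩⟩
  · simp
  · have := hF a (by simp [hL])
    cases ha : g a <;> simp [ha, hL] at this ⊢ <;> omega
  · have ka := hF a (by simp [hL])
    have kb := hF b (by simp [hL])
    have := hE a b
    cases ha : g a <;> cases hb : g b <;> simp [ha, hb, hL] at ka kb this ⊢ <;> omega
  · simp

end NetData

theorem recolorCount_eq_card {f f' : Fin N → Color} {S : Finset ℕ}
    (hS : S = vertexSet fun v => f v ≠ f' v) : recolorCount f f' = S.card := by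
  rw [hS, card_vertexSet, recolorCount]

/-- The result of the algorithm in terms of colourings. -/
theorem NetData.Reduced.exists_minimum {W : ℕ} {D : NetData W} (hN : D.N = N)
    (hnbrs : D.nbrs = shiftedNbrs adj) (h1 : D.need₁ ≤ 1) (h2 : D.need₂ ≤ 2) {f : Fin N → Color}
    (hreds : D.reds = vertexSet fun v => f v = Color.red) {R : Finset ℕ} (hR : D.Reduced R)
    (hR' : D.Admissible R) :
    ∃ f' : Fin N → Color, (∀ v : Fin N, f' v = Color.red ↔ (v : ℕ) + 1 ∈ R) ∧
      recolorCount f f' = (D.reds \ R).card ∧ Meets adj D.need₁ D.need₂ f' ∧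
      ∀ g, Meets adj D.need₁ D.need₂ g → recolorCount f f' ≤ recolorCount f g := by
  classical
  let f' : Fin N → Color := fun v => if (v : ℕ) + 1 ∈ R then Color.red else Color.blue
  have hf' : ∀ v : Fin N, f' v = Color.red ↔ (v : ℕ) + 1 ∈ R := fun v => by simp [f']
  have hcount : recolorCount f f' = (D.reds \ R).card := by
    refine recolorCount_eq_card ?_
    ext a
    rw [Finset.mem_sdiff, hreds, mem_vertexSet, mem_vertexSet]
    constructor
    · rintro ⟨⟨v, hv, rfl⟩, h⟩
      exact ⟨v, by rw [hv]; exact fun h' => h ((hf' v).1 h'.symm), rfl⟩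
    · rintro ⟨v, hv, rfl⟩
      by_cases hvR : (v : ℕ) + 1 ∈ R
      · have h1 := hR.subset hvR
        rw [hreds, succ_mem_vertexSet] at h1
        exact absurd (h1.trans ((hf' v).2 hvR).symm) hv
      · refine ⟨⟨v, ?_, rfl⟩, hvR⟩
        have := Color.ne_red.1 (mt (hf' v).1 hvR)
        rw [this] at hv
        exact Color.ne_blue.1 hv
  refine ⟨f', hf', hcount, hR'.meets hN hnbrs h1 h2 fun v => (hf' v).1, fun g hg => ?_⟩
  -- Vertices red in both colourings. Every other `f`-red vertex is changed by `g`, and changes from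
  -- blue to red only add to its cost.
  let I := vertexSet fun v => f v = Color.red ∧ g v = Color.red
  have hI : I ⊆ D.reds := by
    intro a ha
    obtain ⟨v, hv, rfl⟩ := mem_vertexSet.1 ha
    rw [hreds, succ_mem_vertexSet]
    exact hv.1
  obtain ⟨J, hJ, -, hle⟩ := hR.optimal I hI
    (Admissible.of_meets hN hnbrs hg fun v hv => (succ_mem_vertexSet.1 hv).2)
  have hg' : (D.reds \ I).card ≤ recolorCount f g := by
    rw [recolorCount_eq_card rfl]
    refine Finset.card_le_card fun a ha => ?_
    rw [Finset.mem_sdiff, hreds] at ha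
    obtain ⟨v, hv, rfl⟩ := mem_vertexSet.1 ha.1
    refine succ_mem_vertexSet.2 fun h => ha.2 (succ_mem_vertexSet.2 ⟨hv, h ▸ hv⟩)
  rw [hcount]
  rw [Finset.card_sdiff_of_subset hR.subset]
  rw [Finset.card_sdiff_of_subset hI] at hg'
  have := Finset.card_le_card hJ
  omega

end Network

/-! ### The auxiliary graph -/

section AuxGraph

variable {m n N : ℕ} {G : Digraph (Fin N)}

theorem exists_isAdjList (G : Digraph (Fin N)) : ∃ adj, IsAdjList G adj := by
  classical
  exact ⟨fun v => (Finset.univ.filter (G.Adj v)).toList,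
    fun v => ⟨Finset.nodup_toList _, fun u => by simp⟩⟩

/-- Among one or two out-neighbours, a strict red majority is unanimity. -/
theorem IsOutwardGrid.underIllusion_iff (h : IsOutwardGrid m n G) (g : Fin N → Color)
    (x : Fin N) : UnderIllusion G g x ↔
      (∃ u, G.Adj x u) ∧ ∀ u, G.Adj x u → g u = Color.red := by
  classical
  obtain ⟨adj, hadj⟩ := exists_isAdjList G
  have hx := h.length_le hadj x
  rw [UnderIllusion, deficiency, redCount_eq hadj, blueCount_eq hadj]
  simp only [← (hadj x).2]
  rcases hL : adj x with _ | ⟨a, _ | ⟨b, _ | ⟨c, l⟩⟩⟩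
  · simp
  · cases ha : g a <;> simp [ha]
  · cases ha : g a <;> cases hb : g b <;> simp [ha, hb]
  · simp [hL] at hx

theorem IsOutwardGrid.isAcyclic_auxGraph (h : IsOutwardGrid m n G) (f : Fin N → Color) :
    (auxGraph G f).IsAcyclic := by
  classical
  obtain ⟨row, h1, -, h3⟩ := h.exists_row
  have hadj : ∀ a b, (auxGraph G f).Adj a b →
      ∃ x, G.Adj x a ∧ G.Adj x b ∧ (a : Fin N) ≠ b := by
    rintro a b ⟨hab, x, -, hx⟩
    have ha : (a : Fin N) ∈ outNbrs G x := by rw [hx]; simp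
    have hb : (b : Fin N) ∈ outNbrs G x := by rw [hx]; simp
    exact ⟨x, ha, hb, fun h => hab (Subtype.ext h)⟩
  intro u p hp
  -- A vertex of least row on the cycle has two distinct cycle neighbours, both in larger rows,
  -- against uniqueness.
  obtain ⟨w, hw, hmin⟩ := Finset.exists_min_image p.support.toFinset (fun w => row w)
    ⟨u, by simp⟩
  rw [List.mem_toFinset] at hw
  obtain ⟨a, b, hab, he⟩ := Set.ncard_eq_two.1 (hp.ncard_neighborSet_toSubgraph_eq_two hw)
  have key : ∀ c, c ∈ p.toSubgraph.neighborSet w →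
      ∃ x, G.Adj x w ∧ G.Adj x c ∧ (w : Fin N) ≠ c ∧ row w < row c := by
    intro c hc
    obtain ⟨x, hx, hx', hne⟩ := hadj _ _ (p.toSubgraph.adj_sub hc)
    have hcs : c ∈ p.support := by
      rw [← SimpleGraph.Walk.mem_verts_toSubgraph]
      exact p.toSubgraph.edge_vert hc.symm
    exact ⟨x, hx, hx', hne, lt_of_le_of_ne (hmin c (List.mem_toFinset.2 hcs))
      (h1 x w c hx hx' hne).symm⟩
  obtain ⟨x, hxw, hxa, hwa, hra⟩ := key a (by rw [he]; simp)
  obtain ⟨y, hyw, hyb, hwb, hrb⟩ := key b (by rw [he]; simp)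
  exact hab (Subtype.ext (h3 x y w a b hxw hxa hwa hyw hyb hwb (by simp [hra, hrb])).1)

theorem paintBlue_eq_red {f : Fin N → Color} {S : Set (Fin N)} {v : Fin N} :
    paintBlue f S v = Color.red ↔ v ∉ S ∧ f v = Color.red := by
  classical
  rw [paintBlue]
  split_ifs with h <;> simp [h]

/-- Any illusion-free `g` recolours the forced red vertices `D`, and its blue vertices among the
remaining red ones form a vertex cover `T` disjoint from `D`. The painted colouring changes nothing
outside `D` and `S`, and `|S| ≤ |T|`. -/
theorem IsOutwardGrid.isMinRecoloring_paintBlue (h : IsOutwardGrid m n G) (f : Fin N → Color)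
    (S : Set {v : Fin N // degreeOneRule G f v = Color.red})
    (hS : IsMinVertexCover (auxGraph G (degreeOneRule G f)) S) :
    IsMinRecoloring G f (paintBlue (degreeOneRule G f) (Subtype.val '' S)) := by
  obtain ⟨-, -, hthree, -⟩ := h.exists_row
  have hred : ∀ v, degreeOneRule G f v = Color.red ↔ (¬ ∃ x, outNbrs G x = {v}) ∧ f v = Color.red :=
    fun v => paintBlue_eq_red
  constructor
  · intro x hx
    obtain ⟨⟨u, hu⟩, hall⟩ := (h.underIllusion_iff _ x).1 hx
    have hall' := fun v hv => paintBlue_eq_red.1 (hall v hv)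
    have hou : outNbrs G x ≠ {u} := fun he => ((hred u).1 (hall' u hu).2).1 ⟨x, he⟩
    obtain ⟨v, hv, hvu⟩ : ∃ v, G.Adj x v ∧ v ≠ u := by
      by_contra! hne
      exact hou (Set.eq_singleton_iff_unique_mem.2 ⟨hu, hne⟩)
    have he : outNbrs G x = {u, v} := by
      ext w
      constructor
      · intro hw
        have := hthree x u v w hu hv hw
        grind
      · rintro (rfl | rfl) <;> assumption
    rcases hS.1 (v := ⟨u, (hall' u hu).2⟩) (w := ⟨v, (hall' v hv).2⟩)
      ⟨fun h => hvu (congrArg Subtype.val h).symm, x,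
        (h.underIllusion_iff _ x).2 ⟨⟨u, hu⟩, fun v hv => (hall' v hv).2⟩, he⟩ with hm | hm
    · exact (hall' u hu).1 ⟨_, hm, rfl⟩
    · exact (hall' v hv).1 ⟨_, hm, rfl⟩
  · intro g hg
    let T : Set {v : Fin N // degreeOneRule G f v = Color.red} := {v | g v = Color.blue}
    have hT : (auxGraph G (degreeOneRule G f)).IsVertexCover T := by
      rintro a b ⟨-, x, -, hx⟩
      by_contra! hab
      refine hg x ((h.underIllusion_iff g x).2 ⟨⟨a, ?_⟩, fun u hu => ?_⟩)
      · change (a : Fin N) ∈ outNbrs G x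
        rw [hx]
        simp
      · change u ∈ outNbrs G x at hu
        rw [hx] at hu
        rcases hu with rfl | rfl
        · exact Color.ne_blue.1 hab.1
        · exact Color.ne_blue.1 hab.2
    let D : Set (Fin N) := {v | f v = Color.red ∧ ∃ x, outNbrs G x = {v}}
    have hsub : {v | f v ≠ paintBlue (degreeOneRule G f) (Subtype.val '' S) v} ⊆
        D ∪ Subtype.val '' S := by
      intro v hv
      by_contra hv'
      simp only [Set.mem_union, not_or] at hv'
      apply hv
      cases hf : f v
      · refine (Color.ne_red.1 fun h => ?_).symm
        have := ((hred v).1 (paintBlue_eq_red.1 h).2).2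
        simp [hf] at this
      · exact (paintBlue_eq_red.2 ⟨hv'.2, (hred v).2 ⟨fun h => hv'.1 ⟨hf, h⟩, hf⟩⟩).symm
    have hsup : D ∪ Subtype.val '' T ⊆ {v | f v ≠ g v} := by
      rintro v (⟨hv, x, hx⟩ | ⟨v, hv, rfl⟩) he
      · refine hg x ((h.underIllusion_iff g x).2 ⟨⟨v, ?_⟩, fun u hu => ?_⟩)
        · change v ∈ outNbrs G x
          simp [hx]
        · change u ∈ outNbrs G x at hu
          rw [hx] at hu
          rw [Set.mem_singleton_iff.1 hu, ← he, hv]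
      · have h1 := ((hred v).1 v.2).2
        have h2 : g v = Color.blue := hv
        rw [h1, h2] at he
        simp at he
    have hdisj : Disjoint D (Subtype.val '' T) := by
      rw [Set.disjoint_left]
      rintro _ ⟨-, hx⟩ ⟨v, -, rfl⟩
      exact ((hred v).1 v.2).1 hx
    calc recolorCount f _ ≤ (D ∪ Subtype.val '' S).ncard := Set.ncard_le_ncard hsub (Set.toFinite _)
      _ ≤ D.ncard + (Subtype.val '' S).ncard := Set.ncard_union_le _ _
      _ = D.ncard + S.ncard := by rw [Set.ncard_image_of_injective _ Subtype.val_injective]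
      _ ≤ D.ncard + T.ncard := Nat.add_le_add_left (hS.2 T hT) _
      _ = D.ncard + (Subtype.val '' T).ncard := by
        rw [Set.ncard_image_of_injective _ Subtype.val_injective]
      _ = (D ∪ Subtype.val '' T).ncard :=
        (Set.ncard_union_eq hdisj (Set.toFinite _) (Set.toFinite _)).symm
      _ ≤ recolorCount f g := Set.ncard_le_ncard hsup (Set.toFinite _)

end AuxGraph

/-! ### The complete programs -/

namespace Prog

/-- Set the registers that depend on the number of vertices. -/
def prepareOffsets : Prog := (add 5 4 1).seq <| (add 6 5 1).seq <| add 6 6 3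

/-- The preparation of the registers for DIFR. -/
def prepare : Prog :=
  (const 3 1).seq <| (const 4 2).seq <| (load 1 0 0).seq <| (load 2 0 3).seq <|
  (const 7 1).seq <| (const 8 1).seq prepareOffsets

/-- The preparation of the registers for `p`-DIFR. -/
def prepareP : Prog :=
  (const 3 1).seq <| (const 4 4).seq <| (load 1 0 0).seq <| (load 2 0 3).seq <|
  (const 10 2).seq <| (load 10 0 10).seq <| (const 11 3).seq <| (load 11 0 11).seq <|
  (ifLt 0 10
    ((const 7 1).seq <| (sub 12 11 10).seq <| ifLt 12 10 (const 8 2) (const 8 1))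
    skip).seq prepareOffsets

/-- Both problems run `main` after their own preparation, and differ only in the header and in `c₁`,
`c₂`. -/
theorem runsWithin_main {m n N : ℕ} {G : Digraph (Fin N)} {adj : Fin N → List (Fin N)}
    (f : Fin N → Color) (k : ℕ) (hm : 1 ≤ m) (hn : 1 ≤ n) (hG : IsOutwardGrid m n G)
    (hadj : IsAdjList G adj) {P : Prog} {header : List ℕ} {c₁ c₂ : ℕ} (h₁ : c₁ ≤ 1) (h₂ : c₂ ≤ 2)
    (hcost : P.cost ≤ 20)
    (hP : ∀ (W : ℕ) (D : NetData W), 4 ≤ W → D.N = N → D.k = k → D.base = header.length →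
      D.need₁ = c₁ → D.need₂ = c₂ →
      D.inp = (fun i => (header ++ encodeNetwork adj f).getD i 0) →
      P.wp W (fun s => D.Ctx s ∧ s.reg 9 = 0 ∧ ∀ B, B ≠ 0 → ∀ i, s.mem B i = 0)
        (State.init (header ++ encodeNetwork adj f)))
    (Ok : (Fin N → Color) → Prop) (hOk : ∀ g, Ok g ↔ Meets adj c₁ c₂ g) :
    (P.seq main).RunsWithin 200 (header ++ encodeNetwork adj f)
      ((200 : ℕ) * ((m * n : ℝ) * √(m * n : ℝ)))
      (fun s => s.Answers (∃ f', Ok f' ∧ recolorCount f f' ≤ k) ∧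
        ∃ f' : Fin N → Color, (Ok f' ∧ ∀ g, Ok g → recolorCount f f' ≤ recolorCount f g) ∧
          s.Outputs f') := by
  intro W hW _
  have hlen : 1 ≤ (header ++ encodeNetwork adj f).length := by
    rw [List.length_append, length_encodeNetwork]
    omega
  obtain ⟨D, hN, hk, hbase, hn₁, hn₂, hnbrs, hreds, hinp⟩ :=
    hG.exists_netData hadj f header k c₁ c₂ (W := W) (by omega) (by omega)
  obtain ⟨s, t, e, ht, R, hR, hR', h0, hout⟩ :=
    (halts_of_wp (hP W D (by omega) hN hk hbase hn₁ hn₂ hinp)).seq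
      fun s h => NetData.halts_main h.1 h.2.1 h.2.2
  obtain ⟨f', hf', hcount, hmeets, hmin⟩ :=
    hR.exists_minimum hN hnbrs (hn₁ ▸ h₁) (hn₂ ▸ h₂) hreds hR'
  rw [hn₁, hn₂, ← hOk] at hmeets
  simp only [hn₁, hn₂, ← hOk] at hmin
  refine ⟨s, t, e, ?_, ⟨?_, ?_⟩, f', ⟨hmeets, hmin⟩, fun v => ?_⟩
  -- With `N = mn ≥ 1`, `92 N + 80 ≤ 172 N ≤ 200 N √N`.
  · have hmn : (1 : ℝ) ≤ m * n := by exact_mod_cast Nat.mul_pos hm hn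
    have hNmn : (N : ℝ) = m * n := by exact_mod_cast hG.card_eq
    have hsq : (1 : ℝ) ≤ √(m * n : ℝ) := Real.one_le_sqrt.2 hmn
    have ht' : (t : ℝ) ≤ 20 + (92 * N + 60) := by
      have : t ≤ 20 + (92 * N + 60) := by omega
      exact_mod_cast this
    rw [hNmn] at ht'
    push_cast
    nlinarith [mul_le_mul_of_nonneg_left hsq (by linarith : (0 : ℝ) ≤ m * n)]
  · rintro ⟨g, hg, hgk⟩
    rw [h0, if_pos]
    rw [← hcount, hk]
    exact (hmin g hg).trans hgk
  · intro hno
    rw [h0, if_neg]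
    rw [← hcount, hk]
    exact fun h => hno ⟨f', hmeets, h⟩
  · rw [hout v (hN ▸ v.2)]
    have := hf' v
    cases hv : f' v <;> simp_all [Color.code]

end Prog

theorem natCeil_le_one {p : ℚ} (hp : p ≤ 1) : ⌈p⌉₊ ≤ 1 := Nat.ceil_le.2 (by exact_mod_cast hp)

theorem natCeil_mul_two_le {p : ℚ} (hp : p ≤ 1) : ⌈p * 2⌉₊ ≤ 2 :=
  Nat.ceil_le.2 (by push_cast; linarith)

/-- The ceilings of `p` and `2 p` for a rational number `p` in the unit interval, in terms of its
numerator and denominator. -/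
theorem natCeil_eq {p : ℚ} (hp : 0 ≤ p) (hp1 : p ≤ 1) :
    ⌈p⌉₊ = (if 0 < p.num.toNat then 1 else 0) ∧
    ⌈p * 2⌉₊ = if 0 < p.num.toNat then
      (if p.den - p.num.toNat < p.num.toNat then 2 else 1) else 0 := by
  have hnum : 0 ≤ p.num := Rat.num_nonneg.2 hp
  have hq : p * p.den = (p.num.toNat : ℚ) := by
    have : ((p.num.toNat : ℤ) : ℚ) = p.num := by rw [Int.toNat_of_nonneg hnum]
    rw [Rat.mul_den_eq_num, ← this, Int.cast_natCast]
  have hden : (0 : ℚ) < p.den := by exact_mod_cast p.den_pos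
  have h1 := natCeil_le_one hp1
  have h2 := natCeil_mul_two_le hp1
  have hle : p.num.toNat ≤ p.den := by
    have : (p.num.toNat : ℚ) ≤ p.den := by nlinarith
    exact_mod_cast this
  have hpos : 0 < p.num.toNat ↔ 0 < p := by
    rw [← Nat.cast_pos (α := ℚ), ← hq, mul_pos_iff_of_pos_right hden]
  -- The test `1 < 2p`, phrased without doubling the numerator.
  have hhalf : p.den - p.num.toNat < p.num.toNat ↔ 1 < p * 2 := by
    rw [show p.den - p.num.toNat < p.num.toNat ↔ p.den < p.num.toNat * 2 by omega,
      ← Nat.cast_lt (α := ℚ)]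
    push_cast
    rw [← hq]
    constructor <;> intro h <;> nlinarith
  have e1 := Nat.ceil_pos (a := p)
  have e2 := Nat.ceil_pos (a := p * 2)
  have e3 := Nat.lt_ceil (n := 1) (a := p * 2)
  rw [Nat.cast_one] at e3
  simp only [hpos, hhalf]
  by_cases hp0 : 0 < p
  · have hp2 : 0 < p * 2 := by linarith
    rw [if_pos hp0, if_pos hp0]
    refine ⟨by have := e1.2 hp0; omega, ?_⟩
    have := e2.2 hp2
    split_ifs with h
    · have := e3.2 h
      omega
    · have := mt e3.1 h
      omega
  · obtain rfl : p = 0 := le_antisymm (not_lt.1 hp0) hp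
    simp

theorem mainTheorem5 :
    -- DIFR on outward grids is solved in time `O(mn √(mn))`
    (∃ (P : Prog) (C : ℕ), ∀ m n : ℕ, 1 ≤ m → 1 ≤ n →
      ∀ (N : ℕ) (G : Digraph (Fin N)) (adj : Fin N → List (Fin N)) (f : Fin N → Color) (k : ℕ),
        IsOutwardGrid m n G → IsAdjList G adj →
        P.RunsWithin C (encodeDIFR adj f k) (C * ((m * n : ℝ) * √(m * n : ℝ)))
          (fun s => s.Answers (DIFR G f k) ∧
            ∃ f' : Fin N → Color, IsMinRecoloring G f f' ∧ s.Outputs f')) ∧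
    -- `p`-DIFR on outward grids, with `p` part of the input, is solved in time `O(mn √(mn))`
    (∃ (P : Prog) (C : ℕ), ∀ m n : ℕ, 1 ≤ m → 1 ≤ n →
      ∀ (N : ℕ) (G : Digraph (Fin N)) (adj : Fin N → List (Fin N)) (f : Fin N → Color) (k : ℕ)
        (p : ℚ), 0 ≤ p → p ≤ 1 →
        IsOutwardGrid m n G → IsAdjList G adj →
        P.RunsWithin C (encodePDIFR p adj f k) (C * ((m * n : ℝ) * √(m * n : ℝ)))
          (fun s => s.Answers (PDIFR p G f k) ∧
            ∃ f' : Fin N → Color, IsMinPRecoloring p G f f' ∧ s.Outputs f')) ∧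
    -- the auxiliary graph is acyclic, and its minimum vertex covers give minimum recolourings
    (∀ (m n N : ℕ) (G : Digraph (Fin N)) (f : Fin N → Color), IsOutwardGrid m n G →
      (auxGraph G (degreeOneRule G f)).IsAcyclic ∧
      ∀ S : Set {v : Fin N // degreeOneRule G f v = Color.red},
        IsMinVertexCover (auxGraph G (degreeOneRule G f)) S →
        IsMinRecoloring G f (paintBlue (degreeOneRule G f) (Subtype.val '' S))) := by
  refine ⟨⟨Prog.prepare.seq .main, 200, fun m n hm hn N G adj f k hG hadj => ?_⟩,
    ⟨Prog.prepareP.seq .main, 200, fun m n hm hn N G adj f k p hp hp1 hG hadj => ?_⟩,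
    fun m n N G f hG => ⟨hG.isAcyclic_auxGraph _, hG.isMinRecoloring_paintBlue f⟩⟩
  · refine Prog.runsWithin_main f k hm hn hG hadj (header := [N, k]) (c₁ := 1) (c₂ := 1) le_rfl
      (by norm_num) (by simp [Prog.prepare, Prog.prepareOffsets, Prog.cost]) (fun W D hW hN hk hb h1 h2 hinp => ?_)
      _ (illusionFree_iff_meets hadj (hG.length_le hadj))
    have hle := D.le_word
    simp only [Prog.prepare, Prog.prepareOffsets, Prog.wp, State.reg_setReg, State.mem_setReg]
    norm_num [State.init]
    rw [List.length_cons, List.length_singleton] at hb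
    refine ⟨by omega, by omega, by omega, by omega, by omega, by omega, ?_,
      fun B hB i h => absurd h hB⟩
    constructor <;> norm_num [hN, hk, hb, h1, h2, hinp]
  · refine Prog.runsWithin_main f k hm hn hG hadj (header := [N, k, p.num.toNat, p.den])
      (natCeil_le_one hp1) (natCeil_mul_two_le hp1) (by simp [Prog.prepareP, Prog.prepareOffsets, Prog.cost])
      (fun W D hW hN hk hb h1 h2 hinp => ?_) _ (pIllusionFree_iff_meets hadj (hG.length_le hadj) p)
    have hle := D.le_word
    obtain ⟨e1, e2⟩ := natCeil_eq hp hp1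
    rw [← h1] at e1
    rw [← h2] at e2
    clear h1 h2
    simp only [Prog.prepareP, Prog.prepareOffsets, Prog.wp, State.reg_setReg, State.mem_setReg]
    generalize p.num.toNat = a at *
    generalize p.den = b at *
    have h4 : D.base = 4 := hb
    norm_num [State.init]
    refine ⟨by omega, by omega, by omega, by omega, fun ha => ⟨by omega, fun hb => ⟨by omega,
      by omega, by omega, by omega, ?_, fun B hB i h => absurd h hB⟩, fun hb => ⟨by omega,
      by omega, by omega, by omega, ?_, fun B hB i h => absurd h hB⟩⟩, fun ha => ⟨
      by omega, by omega, by omega, ?_, fun B hB i h => absurd h hB⟩⟩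
    · rw [if_pos ha] at e1 e2
      rw [if_pos hb] at e2
      constructor <;> norm_num [hN, hk, h4, e1, e2, hinp, ha]
    · rw [if_pos ha] at e1 e2
      rw [if_neg hb.not_gt] at e2
      constructor <;> norm_num [hN, hk, h4, e1, e2, hinp, ha]
    -- For `p = 0` both requirements are `0`, the initial content of the registers `7` and `8`.
    · constructor <;> norm_num [hN, hk, h4, e1, e2, hinp, ha]
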